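/- Let $U$ be a finite-dimensional complex vector superspace with a homogeneous basis $A=A_{\bar 0}\sqcup A_{\bar 1}$ ($A_{\bar 0}$ even, $A_{\bar 1}$ odd). Let $\phi_U\simeq U$ and $\phi^{\bar U}\simeq \Pi U^*$ be superspaces with bases $(\phi_a)_{a\in A}$ and $(\phi^{\bar a})_{a\in A}$, so that $\phi_a$ has the parity of $a$ and $\phi^{\bar a}$ the opposite parity. Let $F^{ch}_{N=1}$ be the SUSY charged free fermion vertex algebra associated to $U$, that is, the universal enveloping $N_K=1$ SUSY vertex algebra of the $N_K=1$ SUSY Lie conformal algebra $\mathbb C[\partial,D]\otimes(\phi_U\oplus\phi^{\bar U})$ (with $D$ odd, $D^2=\partial$) whose $\Lambda$-bracket, $\Lambda=(\lambda,\chi)$ with $\chi^2=-\lambda$, is given by $$[\phi_a{}_\Lambda\phi^{\bar b}]=\delta_{ab},\qquad [\phi_a{}_\Lambda\phi_b]=[\phi^{\bar a}{}_\Lambda\phi^{\bar b}]=0\qquad(a,b\in A).$$ In an $N_K=1$ SUSY vertex algebra with state-field correspondence $Y(u,z,\theta)=\sum_{j}z^{-j-1}u_{(j|1)}+\theta\sum_j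 z^{-j-1}u_{(j|0)}$ the $\Lambda$-bracket is $[u{}_\Lambda v]=\sum_{j\ge0}\frac{\lambda^j}{j!}u_{(j|0)}v+\chi\sum_{j\ge0}\frac{\lambda^j}{j!}u_{(j|1)}v$, and products of fields are normally ordered, $uv=u_{(-1|1)}v$. For complex numbers $(t_a)_{a\in A}$ put $$T^{ch}_{sh}=\sum_{a\in A_{\bar0}}\big((t_a+1)\,\partial\phi_a\,\phi^{\bar a}+t_a\,\phi_a\,\partial\phi^{\bar a}+D\phi_a\,D\phi^{\bar a}\big)+\sum_{a\in A_{\bar1}}\big(t_a\,\partial\phi_a\,\phi^{\bar a}+(t_a+1)\,\phi_a\,\partial\phi^{\bar a}+D\phi_a\,D\phi^{\bar a}\big).$$ A vector $v$ has conformal weight $\Delta\in\mathbb C$ with respect to $T^{ch}_{sh}$ if $[T^{ch}_{sh}{}_\Lambda v]=(2\partial+2\Delta\lambda+\chi D)v+O(\Lambda^2)$, where $O(\Lambda^2)$ is a polynomial in $\lambda,\chi$ without terms in $1$, $\lambda$ and $\chi$; it is primary if moreover there is no $O(\Lambda^2)$ term. Proposition 4.9. With respect to $T^{ch}_{sh}$,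 for every even $a\in A$ the conformal weights of $\phi_a$ and $\phi^{\bar a}$ are $-\tfrac12t_a$ and $\tfrac12t_a+\tfrac12$ respectively, and for every odd $a\in A$ they are $\tfrac12t_a+\tfrac12$ and $-\tfrac12t_a$ respectively. Moreover, for every $a\in A$ the vectors $\phi_a$ and $\phi^{\bar a}$ are primary. -/

import Mathlib

set_option linter.unusedSectionVars false

namespace SusyVA

noncomputable section

/-- The sign `(-1)^i` of a parity `i`. -/
def sg (i : ZMod 2) : ℂ := if i = 0 then 1 else -1

lemma zmod2_cases (i : ZMod 2) : i = 0 ∨ i = 1 := by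
  revert i; decide

@[simp] lemma sg_zero : sg 0 = 1 := by simp [sg]

@[simp] lemma sg_one : sg 1 = -1 := by simp [sg]

lemma sg_add (i j : ZMod 2) : sg (i + j) = sg i * sg j := by
  rcases zmod2_cases i with rfl | rfl <;> rcases zmod2_cases j with rfl | rfl <;>
    simp [show (1 : ZMod 2) + 1 = 0 from rfl]

lemma sg_mul_self (i : ZMod 2) : sg i * sg i = 1 := by
  rcases zmod2_cases i with rfl | rfl <;> simp

/-- The supercommutator `[f, g] = f g - (-1)^(ij) g f` of endomorphisms of parities `i` and `j`. -/
def scomm {V : Type*} [AddCommGroup V] [Module ℂ V] (i j : ZMod 2) (f g : Module.End ℂ V) :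
    Module.End ℂ V :=
  f * g - sg (i * j) • (g * f)

/-- An `N_K = 1` SUSY vertex algebra. The state-field correspondence
`Y(a, z, θ) = ∑ z^(-n-1) a_(n|1) + θ ∑ z^(-n-1) a_(n|0)` is given by its modes
`mode n i a = a_(n|i)`. -/
structure SUSYVertexAlgebra (V : Type*) [AddCommGroup V] [Module ℂ V] where
  /-- the even and odd parts -/
  gr : ZMod 2 → Submodule ℂ V
  gr_isInternal : DirectSum.IsInternal gr
  /-- the vacuum -/
  vac : V
  vac_mem : vac ∈ gr 0
  /-- the odd endomorphism -/
  D : Module.End ℂ V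
  D_mem : ∀ (i : ZMod 2) (v : V), v ∈ gr i → D v ∈ gr (i + 1)
  /-- `mode n i a` is the endomorphism `a_(n|i)` -/
  mode : ℤ → ZMod 2 → V →ₗ[ℂ] Module.End ℂ V
  /-- `Y` preserves parity, `θ` being odd -/
  mode_mem : ∀ (n : ℤ) (i p q : ZMod 2) (a b : V), a ∈ gr p → b ∈ gr q →
    mode n i a b ∈ gr (p + (i + 1) + q)
  /-- `Y(a, z, θ)` is a superfield -/
  mode_field : ∀ a b : V, ∃ N : ℤ, ∀ n, N ≤ n → ∀ i, mode n i a b = 0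
  /-- the vacuum conditions -/
  D_vac : D vac = 0
  mode_vac_nonneg : ∀ (a : V) (n : ℤ), 0 ≤ n → ∀ i, mode n i a vac = 0
  mode_vac : ∀ a : V, mode (-1) 1 a vac = a
  /-- translation covariance `[D, Y(a, z, θ)] = (∂_θ - θ ∂_z) Y(a, z, θ)`: coefficient of `θ^0` -/
  translation_one : ∀ (p : ZMod 2) (a : V), a ∈ gr p → ∀ n : ℤ,
    scomm 1 p D (mode n 1 a) = mode n 0 a
  /-- translation covariance: coefficient of `θ` -/
  translation_zero : ∀ (p : ZMod 2) (a : V), a ∈ gr p → ∀ n : ℤ,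
    scomm 1 (p + 1) D (mode n 0 a) = (-(n : ℂ)) • mode (n - 1) 1 a
  /-- locality `(z - w)^N [Y(a, z, θ), Y(b, w, ζ)] = 0`: coefficients of `z^(-m-1) w^(-n-1)` for the
  four pairs of components -/
  locality : ∀ (p q : ZMod 2) (a b : V), a ∈ gr p → b ∈ gr q → ∃ N : ℕ,
    ∀ (i j : ZMod 2) (m n : ℤ), ∑ k ∈ Finset.range (N + 1), ((-1 : ℂ) ^ k * (N.choose k : ℂ)) •
      scomm (p + (i + 1)) (q + (j + 1)) (mode (m + N - k) i a) (mode (n + k) j b) = 0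

namespace SUSYVertexAlgebra

variable {V : Type*} [AddCommGroup V] [Module ℂ V] (𝒱 : SUSYVertexAlgebra V)

/-- The even endomorphism `∂ = D^2`. -/
def der (v : V) : V := 𝒱.D (𝒱.D v)

/-- The normally ordered product `:ab: = a_(-1|1) b`. -/
def nprod (a b : V) : V := 𝒱.mode (-1) 1 a b

/-- The `Λ`-bracket
`[a _Λ b] = ∑_j λ^j / j! a_(j|0) b + χ ∑_j λ^j / j! a_(j|1) b`, an element of `ℂ[λ, χ] ⊗ V`.
Elements of `ℂ[λ, χ] ⊗ V` are written uniquely as `∑ λ^j χ^i v_(j,i)` with `i ∈ {0, 1}` and are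
represented by the finitely supported family `v`. -/
def bracket (a b : V) : (ℕ × ZMod 2) →₀ V :=
  Finsupp.ofSupportFinite
    (fun x => ((x.1.factorial : ℂ)⁻¹) • 𝒱.mode x.1 x.2 a b) (by
      obtain ⟨N, hN⟩ := 𝒱.mode_field a b
      refine ((Set.finite_Iio N.toNat).prod (Set.finite_univ)).subset ?_
      rintro ⟨j, i⟩ h
      refine ⟨?_, trivial⟩
      by_contra hc
      have hc : N.toNat ≤ j := not_lt.mp hc
      exact h (by simp [hN j (by have := Int.self_le_toNat N; omega)]))

/-- `(2∂ + 2Δλ + χ D) v` as an element of `ℂ[λ, χ] ⊗ V`. -/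
def weightPart (Δ : ℂ) (v : V) : (ℕ × ZMod 2) →₀ V :=
  Finsupp.single (0, 0) ((2 : ℂ) • 𝒱.der v) + Finsupp.single (1, 0) ((2 * Δ) • v)
    + Finsupp.single (0, 1) (𝒱.D v)

/-- `v` has conformal weight `Δ` with respect to `T`: `[T _Λ v] = (2∂ + 2Δλ + χ D) v + O(Λ^2)`,
where `O(Λ^2)` has no constant and no linear terms (no terms in `1`, `λ`, `χ`). -/
def HasConformalWeight (T v : V) (Δ : ℂ) : Prop :=
  ∃ R : (ℕ × ZMod 2) →₀ V, R (0, 0) = 0 ∧ R (1, 0) = 0 ∧ R (0, 1) = 0 ∧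
    𝒱.bracket T v = 𝒱.weightPart Δ v + R

/-- `v` is primary with respect to `T`: `v` has a conformal weight and there is no `O(Λ^2)`. -/
def IsPrimary (T v : V) : Prop :=
  ∃ Δ : ℂ, 𝒱.bracket T v = 𝒱.weightPart Δ v

end SUSYVertexAlgebra

section Fields

variable {V : Type*} [AddCommGroup V] [Module ℂ V]

/-- Sequences of endomorphisms `(B_n)` with `B_n w = 0` for `n` large: `End V`-valued fields
`B(z) = ∑ z^(-n-1) B_n`. -/
def Fld (V : Type*) [AddCommGroup V] [Module ℂ V] : Submodule ℂ (ℤ → Module.End ℂ V) where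
  carrier := {B | ∀ w, ∃ N : ℤ, ∀ n, N ≤ n → B n w = 0}
  zero_mem' := fun w => ⟨0, fun n _ => by simp⟩
  add_mem' := by
    intro a b ha hb w
    obtain ⟨N, hN⟩ := ha w
    obtain ⟨M, hM⟩ := hb w
    exact ⟨max N M, fun n hn => by
      simp [hN n (le_trans (le_max_left _ _) hn), hM n (le_trans (le_max_right _ _) hn)]⟩
  smul_mem' := by
    intro c a ha w
    obtain ⟨N, hN⟩ := ha w
    exact ⟨N, fun n hn => by simp [hN n hn]⟩

/-- A sequence of vectors that vanishes from some index on. -/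
def EZ (f : ℕ → V) : Prop := ∃ N, ∀ j, N ≤ j → f j = 0

lemma fs_eq {f : ℕ → V} {N : ℕ} (h : ∀ j, N ≤ j → f j = 0) :
    ∑ᶠ j, f j = ∑ j ∈ Finset.range N, f j := by
  apply finsum_eq_sum_of_support_subset
  intro j hj
  simp only [Finset.coe_range, Set.mem_Iio]
  by_contra hc
  exact hj (h j (not_lt.mp hc))

lemma EZ.finite {f : ℕ → V} (h : EZ f) : (Function.support f).Finite := by
  obtain ⟨N, hN⟩ := h
  apply (Set.finite_Iio N).subset
  intro j hj
  by_contra hc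
  exact hj (hN j (not_lt.mp hc))

lemma EZ.add {f g : ℕ → V} (hf : EZ f) (hg : EZ g) : EZ (fun j => f j + g j) := by
  obtain ⟨N, hN⟩ := hf
  obtain ⟨M, hM⟩ := hg
  exact ⟨max N M, fun j hj => by
    simp [hN j (le_trans (le_max_left _ _) hj), hM j (le_trans (le_max_right _ _) hj)]⟩

lemma EZ.map {W : Type*} [AddCommGroup W] [Module ℂ W] {f : ℕ → V} (hf : EZ f)
    (L : V →ₗ[ℂ] W) : EZ (fun j => L (f j)) := by
  obtain ⟨N, hN⟩ := hf
  exact ⟨N, fun j hj => by simp [hN j hj]⟩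

lemma EZ.smul {f : ℕ → V} (hf : EZ f) (c : ℂ) : EZ (fun j => c • f j) := by
  obtain ⟨N, hN⟩ := hf
  exact ⟨N, fun j hj => by simp [hN j hj]⟩

lemma fs_add {f g : ℕ → V} (hf : EZ f) (hg : EZ g) :
    ∑ᶠ j, (f j + g j) = ∑ᶠ j, f j + ∑ᶠ j, g j :=
  finsum_add_distrib hf.finite hg.finite

lemma fs_map {W : Type*} [AddCommGroup W] [Module ℂ W] {f : ℕ → V} (hf : EZ f)
    (L : V →ₗ[ℂ] W) : ∑ᶠ j, L (f j) = L (∑ᶠ j, f j) :=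
  (L.toAddMonoidHom.map_finsum hf.finite).symm

lemma fs_smul {f : ℕ → V} (hf : EZ f) (c : ℂ) : ∑ᶠ j, c • f j = c • ∑ᶠ j, f j :=
  fs_map hf (c • LinearMap.id)

/-- Peeling off the first term. -/
lemma fs_succ {f : ℕ → V} (hf : EZ f) : ∑ᶠ j, f j = f 0 + ∑ᶠ j, f (j + 1) := by
  obtain ⟨N, hN⟩ := hf
  rw [fs_eq (N := N + 1) (fun j hj => hN j (by omega)),
    fs_eq (f := fun j => f (j + 1)) (N := N) (fun j hj => hN _ (by omega)),
    Finset.sum_range_succ', add_comm]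

lemma EZ.succ {f : ℕ → V} (hf : EZ f) : EZ (fun j => f (j + 1)) := by
  obtain ⟨N, hN⟩ := hf
  exact ⟨N, fun j hj => hN _ (by omega)⟩

/-- The `e`-th power of an endomorphism (in practice the parity involution). -/
def tw (P : Module.End ℂ V) (e : ZMod 2) : Module.End ℂ V := if e = 0 then 1 else P

/-- Conjugation by the parity involution, `e` times: multiplies an endomorphism of parity `f` by
`(-1)^(e f)`. -/
def cj (P : Module.End ℂ V) (e : ZMod 2) (X : Module.End ℂ V) : Module.End ℂ V :=
  tw P e * X * tw P e

lemma tw_mul_self {P : Module.End ℂ V} (hP : P * P = 1) (e : ZMod 2) : tw P e * tw P e = 1 := by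
  rcases zmod2_cases e with rfl | rfl <;> simp [tw, hP]

lemma tw_comm (P : Module.End ℂ V) (e f : ZMod 2) : tw P e * tw P f = tw P f * tw P e := by
  rcases zmod2_cases e with rfl | rfl <;> rcases zmod2_cases f with rfl | rfl <;> simp [tw]

lemma cj_mul {P : Module.End ℂ V} (hP : P * P = 1) (e : ZMod 2) (X Y : Module.End ℂ V) :
    cj P e (X * Y) = cj P e X * cj P e Y := by
  have := tw_mul_self hP e
  simp only [cj]
  calc tw P e * (X * Y) * tw P e = tw P e * X * 1 * Y * tw P e := by simp [mul_assoc]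
    _ = _ := by rw [← this]; simp only [mul_assoc]

lemma cj_comm (P : Module.End ℂ V) (e f : ZMod 2) (X : Module.End ℂ V) :
    cj P e (cj P f X) = cj P f (cj P e X) := by
  simp only [cj]
  calc tw P e * (tw P f * X * tw P f) * tw P e
      = (tw P e * tw P f) * X * (tw P f * tw P e) := by simp only [mul_assoc]
    _ = (tw P f * tw P e) * X * (tw P e * tw P f) := by rw [tw_comm P e f]
    _ = _ := by simp only [mul_assoc]

lemma cj_smul (P : Module.End ℂ V) (e : ZMod 2) (c : ℂ) (X : Module.End ℂ V) :
    cj P e (c • X) = c • cj P e X := by simp [cj]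

lemma cj_add (P : Module.End ℂ V) (e : ZMod 2) (X Y : Module.End ℂ V) :
    cj P e (X + Y) = cj P e X + cj P e Y := by simp [cj, mul_add, add_mul]

lemma nop_ez1 (a : ℤ → Module.End ℂ V) (B : Fld V) (n : ℤ) (w : V) :
    EZ (fun j : ℕ => a (-1 - j) (B.1 (n + j) w)) := by
  obtain ⟨N, hN⟩ := B.2 w
  exact ⟨(N - n).toNat, fun j hj => by
    beta_reduce
    rw [hN (n + j) (by have := Int.self_le_toNat (N - n); omega), map_zero]⟩

lemma nop_ez2 (a : Fld V) (B : ℤ → Module.End ℂ V) (n : ℤ) (w : V) :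
    EZ (fun j : ℕ => B (n - 1 - j) (a.1 j w)) := by
  obtain ⟨N, hN⟩ := a.2 w
  exact ⟨N.toNat, fun j hj => by
    beta_reduce
    rw [hN j (by have := Int.self_le_toNat N; omega), map_zero]⟩

/-- The normally ordered product `:a(z)B(z):` of fields, where `a` has parity `e`: its `n`-th mode is
`∑_{j ≥ 0} (a_(-1-j) B_(n+j) + (-1)^(e p(B)) B_(n-1-j) a_(j))`, the sign being implemented by
conjugation with the parity involution `P`. -/
def nop (P : Module.End ℂ V) (e : ZMod 2) (a : Fld V) : Module.End ℂ (Fld V) where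
  toFun B := ⟨fun n =>
    { toFun := fun w => ∑ᶠ j : ℕ, a.1 (-1 - j) (B.1 (n + j) w)
          + ∑ᶠ j : ℕ, cj P e (B.1 (n - 1 - j)) (a.1 j w)
      map_add' := by
        intro v w
        have h1 := nop_ez1 a.1 B n
        have h2 := nop_ez2 a (fun m => cj P e (B.1 m)) n
        simp only [map_add]
        rw [fs_add (h1 v) (h1 w), fs_add (h2 v) (h2 w)]
        abel
      map_smul' := by
        intro c w
        have h1 := nop_ez1 a.1 B n
        have h2 := nop_ez2 a (fun m => cj P e (B.1 m)) n
        simp only [map_smul, RingHom.id_apply, smul_add]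
        rw [fs_smul (h1 w), fs_smul (h2 w)] }, by
    intro w
    obtain ⟨N, hN⟩ := B.2 w
    obtain ⟨M, hM⟩ := a.2 w
    have hK : ∃ K : ℤ, ∀ n, K ≤ n → ∀ j : ℕ, j < M.toNat →
        cj P e (B.1 (n - 1 - j)) (a.1 j w) = 0 := by
      induction M.toNat with
      | zero => exact ⟨0, fun n _ j hj => by omega⟩
      | succ m ih =>
        obtain ⟨K, hK⟩ := ih
        obtain ⟨L, hL⟩ := B.2 (tw P e (a.1 m w))
        refine ⟨max K (L + 1 + m), fun n hn j hj => ?_⟩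
        rcases Nat.lt_succ_iff_lt_or_eq.mp hj with h | rfl
        · exact hK n (le_trans (le_max_left _ _) hn) j h
        · have := le_trans (le_max_right _ _) hn
          simp [cj, hL (n - 1 - j) (by omega)]
    obtain ⟨K, hK⟩ := hK
    refine ⟨max N K, fun n hn => ?_⟩
    have h1 : ∀ j : ℕ, a.1 (-1 - j) (B.1 (n + j) w) = 0 := fun j => by
      rw [hN (n + j) (by have := le_trans (le_max_left _ _) hn; omega), map_zero]
    have h2 : ∀ j : ℕ, cj P e (B.1 (n - 1 - j)) (a.1 j w) = 0 := fun j => by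
      by_cases hj : j < M.toNat
      · exact hK n (le_trans (le_max_right _ _) hn) j hj
      · rw [hM j (by have := Int.self_le_toNat M; omega), map_zero]
    simp [h1, h2]⟩
  map_add' := by
    intro B C
    ext n w
    have h1 := fun B : Fld V => nop_ez1 a.1 B n w
    have h2 := fun B : Fld V => nop_ez2 a (fun m => cj P e (B.1 m)) n w
    simp only [Submodule.coe_add, Pi.add_apply, LinearMap.add_apply, map_add, cj_add,
      LinearMap.coe_mk, AddHom.coe_mk]
    rw [fs_add (h1 B) (h1 C), fs_add (h2 B) (h2 C)]
    abel
  map_smul' := by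
    intro c B
    ext n w
    have h1 := fun B : Fld V => nop_ez1 a.1 B n w
    have h2 := fun B : Fld V => nop_ez2 a (fun m => cj P e (B.1 m)) n w
    simp only [Submodule.coe_smul, Pi.smul_apply, LinearMap.smul_apply, map_smul, cj_smul,
      LinearMap.coe_mk, AddHom.coe_mk, RingHom.id_apply, smul_add]
    rw [fs_smul (h1 B), fs_smul (h2 B)]

lemma nop_apply (P : Module.End ℂ V) (e : ZMod 2) (a B : Fld V) (n : ℤ) (w : V) :
    (nop P e a B).1 n w = ∑ᶠ j : ℕ, a.1 (-1 - j) (B.1 (n + j) w)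
          + ∑ᶠ j : ℕ, cj P e (B.1 (n - 1 - j)) (a.1 j w) := rfl

/-- `a` is homogeneous of parity `f`. -/
def Hom (P : Module.End ℂ V) (f : ZMod 2) (a : Fld V) : Prop :=
  ∀ e n, cj P e (a.1 n) = sg (e * f) • a.1 n

lemma ds_eq (f : ℕ → ℕ → V) (N : ℕ) (h1 : ∀ i j, N ≤ i → f i j = 0) (h2 : ∀ i j, N ≤ j → f i j = 0) :
    ∑ᶠ i, ∑ᶠ j, f i j = ∑ i ∈ Finset.range N, ∑ j ∈ Finset.range N, f i j := by
  have : ∀ i, ∑ᶠ j, f i j = ∑ j ∈ Finset.range N, f i j := fun i => fs_eq (fun j hj => h2 i j hj)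
  simp only [this]
  exact fs_eq (fun i hi => Finset.sum_eq_zero fun j _ => h1 i j hi)

lemma ds_comm {f : ℕ → ℕ → V} (h : ∃ N : ℕ, ∀ i j, N ≤ i ∨ N ≤ j → f i j = 0) :
    ∑ᶠ i, ∑ᶠ j, f i j = ∑ᶠ j, ∑ᶠ i, f i j := by
  obtain ⟨N, h⟩ := h
  rw [ds_eq f N (fun i j hi => h i j (Or.inl hi)) (fun i j hi => h i j (Or.inr hi)),
    ds_eq (fun j i => f i j) N (fun i j hi => h _ _ (Or.inr hi)) (fun i j hi => h _ _ (Or.inl hi)),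
    Finset.sum_comm]

lemma ds_ez {f : ℕ → ℕ → V} (h : ∃ N : ℕ, ∀ i j, N ≤ i ∨ N ≤ j → f i j = 0) :
    EZ (fun i => ∑ᶠ j, f i j) := by
  obtain ⟨N, h⟩ := h
  exact ⟨N, fun i hi => by simp [h i _ (Or.inl hi)]⟩

/-- Uniform bound for finitely many vectors. -/
lemma unif (B : Fld V) (w : ℕ → V) (M : ℕ) :
    ∃ K : ℤ, ∀ n, K ≤ n → ∀ j, j < M → B.1 n (w j) = 0 := by
  induction M with
  | zero => exact ⟨0, fun n _ j hj => by omega⟩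
  | succ m ih =>
    obtain ⟨K, hK⟩ := ih
    obtain ⟨L, hL⟩ := B.2 (w m)
    refine ⟨max K L, fun n hn j hj => ?_⟩
    rcases Nat.lt_succ_iff_lt_or_eq.mp hj with h | rfl
    · exact hK n (le_trans (le_max_left _ _) hn) j h
    · exact hL n (le_trans (le_max_right _ _) hn)

lemma bdA (X : ℕ → ℕ → Module.End ℂ V) (B : Fld V) (n : ℤ) (w : V) :
    ∃ N : ℕ, ∀ i j : ℕ, N ≤ i ∨ N ≤ j → X i j (B.1 (n + i + j) w) = 0 := by
  obtain ⟨N, hN⟩ := B.2 w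
  refine ⟨(N - n).toNat, fun i j hj => ?_⟩
  have := Int.self_le_toNat (N - n)
  rw [hN _ (by omega), map_zero]

lemma bdB (X : ℕ → Module.End ℂ V) (T : Module.End ℂ V) (a B : Fld V) (n : ℤ) (w : V) :
    ∃ N : ℕ, ∀ i j : ℕ, N ≤ i ∨ N ≤ j → X i (B.1 (n + i - 1 - j) (T (a.1 j w))) = 0 := by
  obtain ⟨M, hM⟩ := a.2 w
  obtain ⟨K, hK⟩ := unif B (fun j => T (a.1 j w)) M.toNat
  refine ⟨max M.toNat (K - n + 1 + M.toNat).toNat, fun i j hj => ?_⟩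
  have h1 := Int.self_le_toNat M
  have h2 := Int.self_le_toNat (K - n + 1 + M.toNat)
  by_cases hj2 : j < M.toNat
  · rw [hK _ (by omega) j hj2, map_zero]
  · rw [hM j (by omega)]; simp

lemma bdC (X : ℕ → ℕ → Module.End ℂ V) (b a : Fld V) (w : V) :
    ∃ N : ℕ, ∀ i j : ℕ, N ≤ i ∨ N ≤ j → X i j (b.1 j (a.1 i w)) = 0 := by
  obtain ⟨M, hM⟩ := a.2 w
  obtain ⟨K, hK⟩ := unif b (fun j => (a.1 j w)) M.toNat
  refine ⟨max M.toNat K.toNat, fun i j hj => ?_⟩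
  have h1 := Int.self_le_toNat M
  have h2 := Int.self_le_toNat K
  by_cases hj2 : i < M.toNat
  · rw [hK _ (by omega) i hj2, map_zero]
  · rw [hM i (by omega)]; simp

lemma cj_apply (P : Module.End ℂ V) (e : ZMod 2) (X : Module.End ℂ V) (w : V) :
    cj P e X w = tw P e (X (tw P e w)) := rfl

/-- expansion of a double normally ordered product -/
lemma nop_nop (P : Module.End ℂ V) (hP : P * P = 1) (e f : ZMod 2) (a b : Fld V)
    (B : Fld V) (n : ℤ) (w : V) :
    (nop P e a (nop P f b B)).1 n w =
      (∑ᶠ i : ℕ, ∑ᶠ j : ℕ, (a.1 (-1 - i) * b.1 (-1 - j)) (B.1 (n + i + j) w)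
      + ∑ᶠ i : ℕ, ∑ᶠ j : ℕ, a.1 (-1 - i) (cj P f (B.1 (n + i - 1 - j)) (b.1 j w)))
      + (∑ᶠ j : ℕ, ∑ᶠ i : ℕ, cj P e (b.1 (-1 - i)) (cj P e (B.1 (n + i - 1 - j)) (a.1 j w))
      + ∑ᶠ i : ℕ, ∑ᶠ j : ℕ, (cj P e (cj P f (B.1 (n - 1 - i - 1 - j))))
          ((cj P e (b.1 j)) (a.1 i w))) := by
  have tt : ∀ v, tw P e (tw P e v) = v := fun v => by
    rw [← Module.End.mul_apply, tw_mul_self hP]; rfl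
  rw [nop_apply]
  congr 1
  · rw [← fs_add]
    · congr 1
      ext i
      rw [nop_apply, map_add, ← fs_map (nop_ez1 _ _ _ _),
        ← fs_map (nop_ez2 b (fun m => cj P f (B.1 m)) _ _)]
      rfl
    · exact ds_ez (bdA (fun i j => a.1 (-1 - i) * b.1 (-1 - j)) B n w)
    · exact ds_ez (bdB (fun i => a.1 (-1 - i) * tw P f) (tw P f) b B n w)
  · rw [← fs_add]
    · congr 1
      ext i
      rw [cj_apply, nop_apply, map_add, ← fs_map (nop_ez1 _ _ _ _),
        ← fs_map (nop_ez2 b (fun m => cj P f (B.1 m)) _ _)]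
      congr 1
      · congr 1
        ext j
        simp only [cj_apply, tt]
        rw [show n - 1 - (i : ℤ) + j = n + j - 1 - i by ring]
      · congr 1
        ext j
        simp only [cj_apply, tt]
    · have := bdB (fun i => cj P e (b.1 (-1 - i)) * tw P e) (tw P e) a B n w
      obtain ⟨N, hN⟩ := this
      exact ds_ez ⟨N, fun i j h => hN j i h.symm⟩
    · obtain ⟨N, hN⟩ := bdC (fun i j => (cj P e (cj P f (B.1 (n - 1 - i - 1 - j)))) * tw P e) b
        ⟨fun n => tw P e * a.1 n, fun v => (a.2 v).imp fun N h n hn => by simp [h n hn]⟩ w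
      exact ds_ez ⟨N, fun i j h => hN i j h⟩

lemma nop_comm (P : Module.End ℂ V) (hP : P * P = 1) (e f : ZMod 2) (a b : Fld V)
    (ha : Hom P e a) (hb : Hom P f b)
    (hcr : ∀ i j : ℤ, i < 0 → j < 0 → a.1 i * b.1 j = sg (e * f) • (b.1 j * a.1 i))
    (han : ∀ i j : ℤ, 0 ≤ i → 0 ≤ j → a.1 i * b.1 j = sg (e * f) • (b.1 j * a.1 i)) :
    nop P e a * nop P f b = sg (e * f) • (nop P f b * nop P e a) := by
  ext B n w
  have hs := sg_mul_self (e * f)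
  simp only [Module.End.mul_apply, LinearMap.smul_apply, Submodule.coe_smul, Pi.smul_apply]
  rw [nop_nop P hP, nop_nop P hP, smul_add, smul_add, smul_add]
  have e1 : ∑ᶠ i : ℕ, ∑ᶠ j : ℕ, (a.1 (-1 - i) * b.1 (-1 - j)) (B.1 (n + i + j) w)
      = sg (e * f) • ∑ᶠ i : ℕ, ∑ᶠ j : ℕ, (b.1 (-1 - i) * a.1 (-1 - j)) (B.1 (n + i + j) w) := by
    obtain ⟨N, hN⟩ := bdA (fun i j => a.1 (-1 - i) * b.1 (-1 - j)) B n w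
    rw [ds_comm ⟨N, hN⟩, ← fs_smul (ds_ez (bdA (fun i j => b.1 (-1 - i) * a.1 (-1 - j)) B n w))]
    congr 1; ext i
    obtain ⟨M, hM⟩ := bdA (fun i j => b.1 (-1 - i) * a.1 (-1 - j)) B n w
    rw [← fs_smul ⟨M, fun j hj => hM i j (Or.inr hj)⟩]
    congr 1; ext j
    rw [hcr _ _ (by omega) (by omega), show n + (j : ℤ) + i = n + i + j by ring]
    rfl
  have e2 : ∑ᶠ i : ℕ, ∑ᶠ j : ℕ, a.1 (-1 - i) (cj P f (B.1 (n + i - 1 - j)) (b.1 j w))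
      = sg (e * f) • ∑ᶠ j : ℕ, ∑ᶠ i : ℕ,
        cj P f (a.1 (-1 - i)) (cj P f (B.1 (n + i - 1 - j)) (b.1 j w)) := by
    obtain ⟨N, hN⟩ : ∃ N : ℕ, ∀ i j : ℕ, N ≤ i ∨ N ≤ j →
        a.1 (-1 - i) (cj P f (B.1 (n + i - 1 - j)) (b.1 j w)) = 0 :=
      bdB (fun i => a.1 (-1 - i) * tw P f) (tw P f) b B n w
    obtain ⟨M, hM⟩ : ∃ N : ℕ, ∀ i j : ℕ, N ≤ i ∨ N ≤ j →
        cj P f (a.1 (-1 - i)) (cj P f (B.1 (n + i - 1 - j)) (b.1 j w)) = 0 :=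
      bdB (fun i => cj P f (a.1 (-1 - i)) * tw P f) (tw P f) b B n w
    rw [ds_comm ⟨N, hN⟩, ← fs_smul (ds_ez ⟨M, fun j i h => hM i j h.symm⟩)]
    congr 1; ext j
    rw [← fs_smul ⟨M, fun i hi => hM i j (Or.inl hi)⟩]
    congr 1; ext i
    rw [ha, mul_comm f e, LinearMap.smul_apply, smul_smul, hs, one_smul]
  have e3 : ∑ᶠ j : ℕ, ∑ᶠ i : ℕ, cj P e (b.1 (-1 - i)) (cj P e (B.1 (n + i - 1 - j)) (a.1 j w))
      = sg (e * f) • ∑ᶠ i : ℕ, ∑ᶠ j : ℕ, b.1 (-1 - i) (cj P e (B.1 (n + i - 1 - j)) (a.1 j w)) := by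
    obtain ⟨N, hN⟩ : ∃ N : ℕ, ∀ i j : ℕ, N ≤ i ∨ N ≤ j →
        b.1 (-1 - i) (cj P e (B.1 (n + i - 1 - j)) (a.1 j w)) = 0 :=
      bdB (fun i => b.1 (-1 - i) * tw P e) (tw P e) a B n w
    rw [ds_comm (f := fun i j : ℕ => b.1 (-1 - i) (cj P e (B.1 (n + i - 1 - j)) (a.1 j w))) ⟨N, hN⟩,
      ← fs_smul (ds_ez ⟨N, fun j i h => hN i j h.symm⟩)]
    congr 1; ext j
    rw [← fs_smul ⟨N, fun i hi => hN i j (Or.inl hi)⟩]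
    congr 1; ext i
    rw [hb]; rfl
  have e4 : ∑ᶠ i : ℕ, ∑ᶠ j : ℕ, (cj P e (cj P f (B.1 (n - 1 - i - 1 - j))))
          ((cj P e (b.1 j)) (a.1 i w))
      = sg (e * f) • ∑ᶠ i : ℕ, ∑ᶠ j : ℕ, (cj P f (cj P e (B.1 (n - 1 - i - 1 - j))))
          ((cj P f (a.1 j)) (b.1 i w)) := by
    have key : ∀ i j : ℕ, (cj P e (b.1 j)) (a.1 i w) = sg (e * f) • (cj P f (a.1 i)) (b.1 j w) := by
      intro i j
      rw [hb, ha, mul_comm f e, LinearMap.smul_apply, LinearMap.smul_apply, smul_smul, hs, one_smul,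
        ← Module.End.mul_apply, ← Module.End.mul_apply, han i j (by omega) (by omega)]
      rfl
    obtain ⟨N, hN⟩ : ∃ N : ℕ, ∀ i j : ℕ, N ≤ i ∨ N ≤ j →
        cj P f (cj P e (B.1 (n - 1 - i - 1 - j))) (cj P f (a.1 j) (b.1 i w)) = 0 :=
      bdC (fun i j => cj P f (cj P e (B.1 (n - 1 - i - 1 - j))) * tw P f) a
      ⟨fun n => tw P f * b.1 n, fun v => (b.2 v).imp fun N h n hn => by simp [h n hn]⟩ w
    rw [← fs_smul (ds_ez ⟨N, fun i j h => hN i j h⟩), ds_comm]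
    · congr 1; ext i
      rw [← fs_smul ⟨N, fun j h => hN i j (Or.inr h)⟩]
      congr 1; ext j
      rw [key, map_smul, cj_comm P e f, show n - 1 - (j : ℤ) - 1 - i = n - 1 - i - 1 - j by ring]
    · refine ⟨N, fun i j h => ?_⟩
      rw [key, map_smul, cj_comm P e f, show n - 1 - (i : ℤ) - 1 - j = n - 1 - j - 1 - i by ring]
      rw [show cj P f (cj P e (B.1 (n - 1 - j - 1 - i))) (cj P f (a.1 i) (b.1 j w)) = 0 from
        hN j i h.symm, smul_zero]
  rw [e1, e2, e3, e4]
  abel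


/-! Locality of fields -/

/-- Laurent polynomials act on arrays by shifts of the indices. -/
def act (G : Type*) [AddCommGroup G] (W : Type*) [AddCommGroup W] [Module ℂ W] :
    AddMonoidAlgebra ℂ G →ₐ[ℂ] Module.End ℂ (G → W) :=
  AddMonoidAlgebra.lift ℂ _ G
    { toFun := fun v =>
        { toFun := fun F i => F (i + v.toAdd)
          map_add' := fun _ _ => rfl
          map_smul' := fun _ _ => rfl }
      map_one' := by ext F i; simp
      map_mul' := by
        intro u v
        ext F i
        simp only [toAdd_mul, Module.End.mul_apply, LinearMap.coe_mk, AddHom.coe_mk]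
        rw [add_assoc] }

section Act

variable {G : Type*} [AddCommGroup G] {W : Type*} [AddCommGroup W] [Module ℂ W]

lemma act_single (u : G) (c : ℂ) (F : G → W) (i : G) :
    act G W (AddMonoidAlgebra.single u c) F i = c • F (i + u) := by
  simp [act, AddMonoidAlgebra.lift_single]

/-- `z^u - z^v` -/
def dl (u v : G) : AddMonoidAlgebra ℂ G :=
  AddMonoidAlgebra.single u 1 - AddMonoidAlgebra.single v 1

lemma act_dl (u v : G) (F : G → W) (i : G) :
    act G W (dl u v) F i = F (i + u) - F (i + v) := by
  simp [dl, map_sub, act_single]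

lemma act_dl_pow (u v : G) (N : ℕ) (F : G → W) (i : G) :
    act G W (dl u v ^ N) F i
      = ∑ k ∈ Finset.range (N + 1), ((-1 : ℂ) ^ k * (N.choose k : ℂ)) •
          F (i + (N - k : ℕ) • u + k • v) := by
  have : dl u v ^ N = ∑ k ∈ Finset.range (N + 1),
      AddMonoidAlgebra.single ((N - k : ℕ) • u + k • v) ((-1 : ℂ) ^ k * (N.choose k : ℂ)) := by
    have h : dl u v = AddMonoidAlgebra.single v (-1 : ℂ) + AddMonoidAlgebra.single u (1 : ℂ) := by
      rw [dl, sub_eq_add_neg, add_comm]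
      congr 1
      ext x
      simp [AddMonoidAlgebra.single_neg]
    rw [h, add_pow]
    refine Finset.sum_congr rfl fun k _ => ?_
    rw [AddMonoidAlgebra.single_pow, AddMonoidAlgebra.single_pow,
      AddMonoidAlgebra.single_mul_single]
    have h2 : ((N.choose k : ℕ) : AddMonoidAlgebra ℂ G)
        = AddMonoidAlgebra.single 0 (N.choose k : ℂ) := rfl
    rw [h2, AddMonoidAlgebra.single_mul_single, add_zero, add_comm (k • v)]
    simp
  rw [this, map_sum, LinearMap.sum_apply, Finset.sum_apply]
  refine Finset.sum_congr rfl fun k _ => ?_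
  rw [act_single, add_assoc]

end Act

/-- `(z - w)^N [a(z), b(w)] = 0`, for the commutator with sign `s`: coefficient of
`z^(-m-1) w^(-n-1)`. -/
def LocN (N : ℕ) (s : ℂ) (a b : ℤ → Module.End ℂ V) : Prop :=
  ∀ m n : ℤ, ∑ k ∈ Finset.range (N + 1), ((-1 : ℂ) ^ k * (N.choose k : ℂ)) •
    (a (m + N - k) * b (n + k) - s • (b (n + k) * a (m + N - k))) = 0

/-- The array of commutators. -/
def KK (s : ℂ) (a b : ℤ → Module.End ℂ V) : ℤ × ℤ → Module.End ℂ V :=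
  fun i => a i.1 * b i.2 - s • (b i.2 * a i.1)

abbrev zw : AddMonoidAlgebra ℂ (ℤ × ℤ) := dl ((1 : ℤ), (0 : ℤ)) (0, 1)

lemma locN_iff (N : ℕ) (s : ℂ) (a b : ℤ → Module.End ℂ V) :
    LocN N s a b ↔ act (ℤ × ℤ) _ (zw ^ N) (KK s a b) = 0 := by
  rw [funext_iff]
  refine ⟨fun h i => ?_, fun h m n => ?_⟩
  · rw [act_dl_pow, Pi.zero_apply, ← h i.1 i.2]
    refine Finset.sum_congr rfl fun k hk => ?_
    have hk := Finset.mem_range.mp hk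
    congr 1
    have e1 : (i + (N - k : ℕ) • ((1 : ℤ), (0 : ℤ)) + k • ((0 : ℤ), (1 : ℤ)))
      = (i.1 + N - k, i.2 + k) := by
      ext <;> simp; omega
    rw [e1]; rfl
  · have := h (m, n)
    rw [act_dl_pow, Pi.zero_apply] at this
    rw [← this]
    refine Finset.sum_congr rfl fun k hk => ?_
    have hk := Finset.mem_range.mp hk
    congr 1
    have e1 : ((m, n) + (N - k : ℕ) • ((1 : ℤ), (0 : ℤ)) + k • ((0 : ℤ), (1 : ℤ)))
      = (m + N - k, n + k) := by
      ext <;> simp; omega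
    rw [e1]; rfl

lemma LocN.mono {N M : ℕ} {s : ℂ} {a b : ℤ → Module.End ℂ V} (h : LocN N s a b) (hM : N ≤ M) :
    LocN M s a b := by
  rw [locN_iff] at *
  obtain ⟨k, rfl⟩ := Nat.exists_eq_add_of_le hM
  rw [pow_add, mul_comm, map_mul, Module.End.mul_apply, h, map_zero]

/-- Transport of `(z-w)^N K = 0` to arrays with three indices. -/
lemma LocN.transport {N : ℕ} {s : ℂ} {a b : ℤ → Module.End ℂ V} (h : LocN N s a b)
    {u v : ℤ × ℤ × ℤ} {F : ℤ × ℤ × ℤ → V} {i : ℤ × ℤ × ℤ} (L : Module.End ℂ V →ₗ[ℂ] V) (m n : ℤ)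
    (hF : ∀ k l : ℕ, F (i + k • u + l • v) = L (KK s a b (m + k, n + l))) :
    act _ V (dl u v ^ N) F i = 0 := by
  rw [act_dl_pow]
  have h2 := congrArg L (h m n)
  rw [map_zero, map_sum] at h2
  rw [← h2]
  refine Finset.sum_congr rfl fun k hk => ?_
  have hk := Finset.mem_range.mp hk
  rw [hF, map_smul, Nat.cast_sub (by omega), ← add_sub_assoc]
  rfl

/-- Arrays vanishing when the second index is large. -/
def XF (V : Type*) [AddCommGroup V] [Module ℂ V] : Submodule ℂ (ℤ × ℤ × ℤ → V) where
  carrier := {F | ∀ r, ∃ Q : ℤ, ∀ q, Q ≤ q → ∀ p, F (p, q, r) = 0}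
  zero_mem' := fun _ => ⟨0, fun _ _ _ => rfl⟩
  add_mem' := by
    intro F F' hF hF' r
    obtain ⟨Q, hQ⟩ := hF r
    obtain ⟨Q', hQ'⟩ := hF' r
    exact ⟨max Q Q', fun q hq p => by
      simp [hQ q (le_trans (le_max_left _ _) hq) p, hQ' q (le_trans (le_max_right _ _) hq) p]⟩
  smul_mem' := by
    intro c F hF r
    obtain ⟨Q, hQ⟩ := hF r
    exact ⟨Q, fun q hq p => by simp [hQ q hq p]⟩

/-- Arrays vanishing when the first index is large. -/
def XG (V : Type*) [AddCommGroup V] [Module ℂ V] : Submodule ℂ (ℤ × ℤ × ℤ → V) where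
  carrier := {F | ∀ r, ∃ Q : ℤ, ∀ p, Q ≤ p → ∀ q, F (p, q, r) = 0}
  zero_mem' := fun _ => ⟨0, fun _ _ _ => rfl⟩
  add_mem' := by
    intro F F' hF hF' r
    obtain ⟨Q, hQ⟩ := hF r
    obtain ⟨Q', hQ'⟩ := hF' r
    exact ⟨max Q Q', fun q hq p => by
      simp [hQ q (le_trans (le_max_left _ _) hq) p, hQ' q (le_trans (le_max_right _ _) hq) p]⟩
  smul_mem' := by
    intro c F hF r
    obtain ⟨Q, hQ⟩ := hF r
    exact ⟨Q, fun q hq p => by simp [hQ q hq p]⟩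

lemma act_mem (S : Submodule ℂ (ℤ × ℤ × ℤ → V))
    (hS : ∀ u : ℤ × ℤ × ℤ, ∀ F ∈ S, (fun i => F (i + u)) ∈ S)
    (x : AddMonoidAlgebra ℂ (ℤ × ℤ × ℤ)) {F : ℤ × ℤ × ℤ → V} (hF : F ∈ S) :
    act _ V x F ∈ S := by
  induction x using AddMonoidAlgebra.induction_linear with
  | zero => simp
  | add f g hf hg => rw [map_add, LinearMap.add_apply]; exact S.add_mem hf hg
  | single u c =>
    have : act _ V (AddMonoidAlgebra.single u c) F = c • (fun i => F (i + u)) := by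
      ext i; rw [act_single]; rfl
    rw [this]
    exact S.smul_mem c (hS u F hF)

lemma XF_act (x : AddMonoidAlgebra ℂ (ℤ × ℤ × ℤ)) {F : ℤ × ℤ × ℤ → V} (hF : F ∈ XF V) :
    act _ V x F ∈ XF V := by
  refine act_mem (XF V) (fun u F hF => ?_) x hF
  intro r
  obtain ⟨Q, hQ⟩ := hF (r + u.2.2)
  exact ⟨Q - u.2.1, fun q hq p => hQ (q + u.2.1) (by omega) (p + u.1)⟩

lemma XG_act (x : AddMonoidAlgebra ℂ (ℤ × ℤ × ℤ)) {F : ℤ × ℤ × ℤ → V} (hF : F ∈ XG V) :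
    act _ V x F ∈ XG V := by
  refine act_mem (XG V) (fun u F hF => ?_) x hF
  intro r
  obtain ⟨Q, hQ⟩ := hF (r + u.2.2)
  exact ⟨Q - u.1, fun p hp q => hQ (p + u.1) (by omega) (q + u.2.1)⟩

/-- The residue defining the normally ordered product. -/
def RR (F G : ℤ × ℤ × ℤ → V) : ℤ × ℤ → V := fun i =>
  ∑ᶠ j : ℕ, F (-1 - j, i.1 + j, i.2) + ∑ᶠ j : ℕ, G (j, i.1 - 1 - j, i.2)

lemma XF_ez {F : ℤ × ℤ × ℤ → V} (hF : F ∈ XF V) (n r : ℤ) (g : ℕ → ℤ) :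
    EZ (fun j : ℕ => F (g j, n + j, r)) := by
  obtain ⟨Q, hQ⟩ := hF r
  exact ⟨(Q - n).toNat, fun j hj => hQ _ (by have := Int.self_le_toNat (Q - n); omega) _⟩

lemma XG_ez {F : ℤ × ℤ × ℤ → V} (hF : F ∈ XG V) (r : ℤ) (g : ℕ → ℤ) :
    EZ (fun j : ℕ => F (j, g j, r)) := by
  obtain ⟨Q, hQ⟩ := hF r
  exact ⟨Q.toNat, fun j hj => hQ _ (by have := Int.self_le_toNat Q; omega) _⟩

lemma RR_add {F F' G G' : ℤ × ℤ × ℤ → V} (hF : F ∈ XF V) (hF' : F' ∈ XF V) (hG : G ∈ XG V)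
    (hG' : G' ∈ XG V) : RR (F + F') (G + G') = RR F G + RR F' G' := by
  ext i
  simp only [RR, Pi.add_apply]
  rw [fs_add (XF_ez hF i.1 i.2 _) (XF_ez hF' i.1 i.2 _), fs_add (XG_ez hG i.2 _) (XG_ez hG' i.2 _)]
  abel

lemma EZ.sub {f g : ℕ → V} (hf : EZ f) (hg : EZ g) : EZ (fun j => f j - g j) := by
  obtain ⟨N, hN⟩ := hf
  obtain ⟨M, hM⟩ := hg
  exact ⟨max N M, fun j hj => by
    simp [hN j (le_trans (le_max_left _ _) hj), hM j (le_trans (le_max_right _ _) hj)]⟩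

lemma fs_sub {f g : ℕ → V} (hf : EZ f) (hg : EZ g) :
    ∑ᶠ j, (f j - g j) = ∑ᶠ j, f j - ∑ᶠ j, g j :=
  finsum_sub_distrib hf.finite hg.finite

lemma RR_tele {H : ℤ × ℤ × ℤ → V} (h1 : H ∈ XF V) (h2 : H ∈ XG V) :
    RR (act _ V (dl (1, 0, 0) (0, 1, 0)) H) (act _ V (dl (1, 0, 0) (0, 1, 0)) H) = 0 := by
  ext ⟨n, r⟩
  simp only [RR, act_dl, Prod.mk_add_mk, add_zero, Pi.zero_apply]
  have e1 : EZ (fun j : ℕ => H (-j, n + j, r)) := XF_ez h1 n r _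
  have e2 : EZ (fun j : ℕ => H (j, n - j, r)) := XG_ez h2 r _
  have t1 := fs_succ e1
  have t2 := fs_succ e2
  have c1 : ∀ j : ℕ, H (-1 - j + 1, n + j, r) - H (-1 - j, n + j + 1, r)
      = H (-j, n + j, r) - H (-((j + 1 : ℕ) : ℤ), n + ((j + 1 : ℕ) : ℤ), r) := fun j => by
    congr 3 <;> push_cast <;> ring_nf
  have c2 : ∀ j : ℕ, H (j + 1, n - 1 - j, r) - H (j, n - 1 - j + 1, r)
      = H (((j + 1 : ℕ) : ℤ), n - ((j + 1 : ℕ) : ℤ), r) - H (j, n - j, r) := fun j => by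
    congr 3 <;> push_cast <;> ring_nf
  simp only [c1, c2]
  rw [fs_sub e1 e1.succ, fs_sub e2.succ e2, t1, t2]
  simp

lemma RR_step {F G : ℤ × ℤ × ℤ → V} (hF : F ∈ XF V) (hG : G ∈ XG V) :
    RR (act _ V (dl (0, 1, 0) (0, 0, 1)) F) (act _ V (dl (0, 1, 0) (0, 0, 1)) G)
      = act _ V zw (RR F G) := by
  ext ⟨n, r⟩
  simp only [RR, act_dl, Prod.mk_add_mk, add_zero]
  rw [fs_sub, fs_sub]
  · have c1 : ∀ j : ℕ, n + (j : ℤ) + 1 = n + 1 + j := fun j => by ring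
    have c2 : ∀ j : ℕ, n - 1 - (j : ℤ) + 1 = n + 1 - 1 - j := fun j => by ring
    simp only [c1, c2]
    abel
  · exact XG_ez hG r _
  · exact XG_ez hG (r + 1) _
  · have := XF_ez hF (n + 1) r (fun j => -1 - (j : ℤ))
    convert this using 5
    ring
  · exact XF_ez hF n (r + 1) _

lemma RR_pow {F G : ℤ × ℤ × ℤ → V} (hF : F ∈ XF V) (hG : G ∈ XG V) (M : ℕ) :
    RR (act _ V (dl (0, 1, 0) (0, 0, 1) ^ M) F) (act _ V (dl (0, 1, 0) (0, 0, 1) ^ M) G)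
      = act _ V (zw ^ M) (RR F G) := by
  induction M with
  | zero => simp
  | succ M ih =>
    rw [pow_succ', pow_succ', map_mul, map_mul, Module.End.mul_apply,
      Module.End.mul_apply, Module.End.mul_apply, RR_step (XF_act _ hF) (XG_act _ hG), ih]

/-- The binomial argument behind Dong's lemma. -/
lemma pow_split {A : Type*} [CommRing A] (z w u : A) (N : ℕ) :
    ∃ p q : A, (w - u) ^ (3 * N) = (z - w) * (p * (z - w) ^ N)
      + q * ((z - u) ^ N * (w - u) ^ N) := by
  have h : (w - u) ^ (2 * N) ∈ Ideal.span {(z - w) ^ (N + 1), (z - u) ^ N} := by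
    have e : w - u = (-(z - w)) + (z - u) := by ring
    rw [e]
    refine Ideal.add_pow_mem_of_pow_mem_of_le _ (m := N + 1) (n := N) ?_ ?_ (by omega)
    · rw [neg_pow]
      exact Ideal.mul_mem_left _ _ (Ideal.subset_span (by simp))
    · exact Ideal.subset_span (by simp)
  obtain ⟨p, q, hpq⟩ := Ideal.mem_span_pair.mp h
  refine ⟨p * (w - u) ^ N, q, ?_⟩
  rw [show 3 * N = 2 * N + N by ring, pow_add, ← hpq]
  ring

abbrev d12 : AddMonoidAlgebra ℂ (ℤ × ℤ × ℤ) := dl ((1 : ℤ), (0 : ℤ), (0 : ℤ)) (0, 1, 0)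

abbrev d13 : AddMonoidAlgebra ℂ (ℤ × ℤ × ℤ) := dl ((1 : ℤ), (0 : ℤ), (0 : ℤ)) (0, 0, 1)

abbrev d23 : AddMonoidAlgebra ℂ (ℤ × ℤ × ℤ) := dl ((0 : ℤ), (1 : ℤ), (0 : ℤ)) (0, 0, 1)

lemma kill12 {N : ℕ} {s : ℂ} {a b : ℤ → Module.End ℂ V} (h : LocN N s a b)
    (L : ℤ → Module.End ℂ V) (v : ℤ → V) :
    act _ V (d12 ^ N) (fun i => L i.2.2 (KK s a b (i.1, i.2.1) (v i.2.2))) = 0 := by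
  ext i
  refine h.transport ((L i.2.2).comp (LinearMap.applyₗ (v i.2.2))) i.1 i.2.1 fun k l => ?_
  simp

lemma kill13 {N : ℕ} {s : ℂ} {a b : ℤ → Module.End ℂ V} (h : LocN N s a b)
    (L : ℤ → Module.End ℂ V) (v : ℤ → V) :
    act _ V (d13 ^ N) (fun i => L i.2.1 (KK s a b (i.1, i.2.2) (v i.2.1))) = 0 := by
  ext i
  refine h.transport ((L i.2.1).comp (LinearMap.applyₗ (v i.2.1))) i.1 i.2.2 fun k l => ?_
  simp

lemma kill23 {N : ℕ} {s : ℂ} {a b : ℤ → Module.End ℂ V} (h : LocN N s a b)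
    (L : ℤ → Module.End ℂ V) (v : ℤ → V) :
    act _ V (d23 ^ N) (fun i => L i.1 (KK s a b (i.2.1, i.2.2) (v i.1))) = 0 := by
  ext i
  refine h.transport ((L i.1).comp (LinearMap.applyₗ (v i.1))) i.2.1 i.2.2 fun k l => ?_
  simp

lemma act_mul_kill {x y : AddMonoidAlgebra ℂ (ℤ × ℤ × ℤ)} {H H1 H2 : ℤ × ℤ × ℤ → V}
    (h : H = H1 + H2) (h1 : act _ V y H1 = 0) (h2 : act _ V x H2 = 0) :
    act _ V (x * y) H = 0 := by
  have e1 : act _ V (x * y) H1 = 0 := by rw [map_mul, Module.End.mul_apply, h1, map_zero]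
  have e2 : act _ V (x * y) H2 = 0 := by
    rw [mul_comm, map_mul, Module.End.mul_apply, h2, map_zero]
  rw [h, map_add, e1, e2, add_zero]

/-- Dong's lemma for normally ordered products. -/
lemma dong {P : Module.End ℂ V} {e f : ZMod 2} {a b c : Fld V} (hb : Hom P f b)
    {sa sb : ℂ} {N : ℕ} (hac : LocN N sa a.1 c.1) (hbc : LocN N sb b.1 c.1)
    (hab : LocN N (sg (e * f)) a.1 b.1) :
    LocN (3 * N) (sa * sb) (nop P e a b).1 c.1 := by
  rw [locN_iff]
  set s := sg (e * f) with hs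
  suffices h : ∀ w : V, act (ℤ × ℤ) V (zw ^ (3 * N))
      (fun i => KK (sa * sb) (nop P e a b).1 c.1 i w) = 0 by
    ext i w
    have h2 := congrFun (h w) i
    rw [act_dl_pow] at h2 ⊢
    simpa [LinearMap.sum_apply] using h2
  intro w
  let F : ℤ × ℤ × ℤ → V := fun i =>
    a.1 i.1 (b.1 i.2.1 (c.1 i.2.2 w)) - (sa * sb) • c.1 i.2.2 (a.1 i.1 (b.1 i.2.1 w))
  let G : ℤ × ℤ × ℤ → V := fun i =>
    s • (b.1 i.2.1 (a.1 i.1 (c.1 i.2.2 w)) - (sa * sb) • c.1 i.2.2 (b.1 i.2.1 (a.1 i.1 w)))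
  have hF : F ∈ XF V := fun r => by
    obtain ⟨Q, hQ⟩ := b.2 (c.1 r w)
    obtain ⟨Q', hQ'⟩ := b.2 w
    exact ⟨max Q Q', fun q hq p => by
      simp [F, hQ q (le_trans (le_max_left _ _) hq), hQ' q (le_trans (le_max_right _ _) hq)]⟩
  have hG : G ∈ XG V := fun r => by
    obtain ⟨Q, hQ⟩ := a.2 (c.1 r w)
    obtain ⟨Q', hQ'⟩ := a.2 w
    exact ⟨max Q Q', fun q hq p => by
      simp [G, hQ q (le_trans (le_max_left _ _) hq), hQ' q (le_trans (le_max_right _ _) hq)]⟩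
  have hR : (fun i => KK (sa * sb) (nop P e a b).1 c.1 i w) = RR F G := by
    ext ⟨n, r⟩
    have cb : ∀ n v, cj P e (b.1 n) v = s • b.1 n v := fun n v => by rw [hb]; rfl
    have z1 := fun v => nop_ez1 a.1 b n v
    have z2 := fun v => nop_ez2 a b.1 n v
    simp only [KK, LinearMap.sub_apply, LinearMap.smul_apply, Module.End.mul_apply, nop_apply, cb,
      RR, F, G]
    rw [fs_smul (z2 _), fs_smul (z2 _), fs_sub (z1 _) (((z1 w).map (c.1 r)).smul _),
      fs_smul ((z1 w).map (c.1 r)), fs_map (z1 w),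
      fs_smul ((z2 _).sub (((z2 w).map (c.1 r)).smul (sa * sb))),
      fs_sub (z2 _) (((z2 w).map (c.1 r)).smul _), fs_smul ((z2 w).map (c.1 r)), fs_map (z2 w)]
    simp only [map_add, map_smul, smul_add, smul_sub]
    rw [smul_comm (sa * sb) s]
    abel
  rw [hR, ← RR_pow hF hG]
  obtain ⟨p, q, hpq⟩ := pow_split (AddMonoidAlgebra.single ((1 : ℤ), (0 : ℤ), (0 : ℤ)) (1 : ℂ))
    (AddMonoidAlgebra.single (0, 1, 0) 1) (AddMonoidAlgebra.single (0, 0, 1) 1) N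
  change d23 ^ (3 * N) = d12 * (p * d12 ^ N) + q * (d13 ^ N * d23 ^ N) at hpq
  have hFG : act _ V (d12 ^ N) F = act _ V (d12 ^ N) G := by
    have e : F = G + (fun i => (1 : Module.End ℂ V) (KK s a.1 b.1 (i.1, i.2.1) (c.1 i.2.2 w)))
        - (sa * sb) • (fun i => c.1 i.2.2 (KK s a.1 b.1 (i.1, i.2.1) w)) := by
      ext i
      simp [F, G, KK, smul_sub, smul_smul]
      rw [mul_comm s (sa * sb)]
      abel
    rw [e, map_sub, map_add, map_smul, kill12 hab (fun _ => 1) (fun r => c.1 r w),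
      kill12 hab c.1 (fun _ => w)]
    simp
  have killF : act _ V (d13 ^ N * d23 ^ N) F = 0 := by
    refine act_mul_kill (H1 := fun i => a.1 i.1 (KK sb b.1 c.1 (i.2.1, i.2.2) w))
      (H2 := sb • fun i => (1 : Module.End ℂ V) (KK sa a.1 c.1 (i.1, i.2.2) (b.1 i.2.1 w)))
      ?_ (kill23 hbc a.1 (fun _ => w)) ?_
    · ext i
      simp [F, KK, smul_sub, smul_smul]
      rw [mul_comm sb sa]
    · rw [map_smul, kill13 hac (fun _ => 1) (fun q => b.1 q w), smul_zero]
  have killG : act _ V (d13 ^ N * d23 ^ N) G = 0 := by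
    refine act_mul_kill
      (H1 := (s * sa) • fun i => (1 : Module.End ℂ V) (KK sb b.1 c.1 (i.2.1, i.2.2) (a.1 i.1 w)))
      (H2 := s • fun i => b.1 i.2.1 (KK sa a.1 c.1 (i.1, i.2.2) w)) ?_ ?_ ?_
    · ext i
      simp [G, KK, smul_sub, smul_smul]
      rw [mul_assoc]
    · rw [map_smul, kill23 hbc (fun _ => 1) (fun q => a.1 q w), smul_zero]
    · rw [map_smul, kill13 hac b.1 (fun _ => w), smul_zero]
  rw [hpq, map_add, LinearMap.add_apply, LinearMap.add_apply,
    RR_add (XF_act _ hF) (XF_act _ hF) (XG_act _ hG) (XG_act _ hG)]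
  have q1 : ∀ H : ℤ × ℤ × ℤ → V, act _ V (q * (d13 ^ N * d23 ^ N)) H
      = act _ V q (act _ V (d13 ^ N * d23 ^ N) H) := fun H => by
    rw [map_mul, Module.End.mul_apply]
  have q2 : ∀ H : ℤ × ℤ × ℤ → V, act _ V (d12 * (p * d12 ^ N)) H
      = act _ V d12 (act _ V p (act _ V (d12 ^ N) H)) := fun H => by
    rw [map_mul, map_mul, Module.End.mul_apply, Module.End.mul_apply]
  rw [q1, q1, q2, q2, killF, killG, hFG, RR_tele]
  · ext i; simp [RR]
  · rw [← hFG]; exact XF_act _ (XF_act _ hF)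
  · exact XG_act _ (XG_act _ hG)

lemma LocN.symm {N : ℕ} {s : ℂ} (hs : s * s = 1) {a b : ℤ → Module.End ℂ V} (h : LocN N s a b) :
    LocN N s b a := by
  intro m n
  have h2 := congrArg (fun X => (-(s * (-1 : ℂ) ^ N)) • X) (h n m)
  simp only [smul_zero, Finset.smul_sum] at h2
  rw [← Finset.sum_range_reflect] at h2
  rw [← h2]
  refine Finset.sum_congr rfl fun k hk => ?_
  have hk := Finset.mem_range.mp hk
  have e0 : N + 1 - 1 - k = N - k := by omega
  have e1 : n + (N : ℤ) - ((N - k : ℕ) : ℤ) = n + k := by omega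
  have e2 : m + ((N - k : ℕ) : ℤ) = m + N - k := by omega
  rw [e0, e1, e2, Nat.choose_symm (by omega), smul_smul]
  have e3 : (-1 : ℂ) ^ N * (-1) ^ (N - k) = (-1) ^ k := by
    rw [← pow_add, show N + (N - k) = 2 * (N - k) + k by omega, pow_add, pow_mul]
    simp
  have e4 : -(s * (-1 : ℂ) ^ N) * ((-1) ^ (N - k) * (N.choose k : ℂ))
      = (((-1) ^ k) * (N.choose k : ℂ)) * (-s) := by
    rw [← e3]; ring
  rw [e4, mul_smul (((-1) ^ k) * (N.choose k : ℂ)) (-s)]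
  congr 1
  rw [smul_sub, neg_smul, neg_smul, smul_smul, hs, one_smul]
  abel

lemma LocN.add {N : ℕ} {s : ℂ} {a b b' : ℤ → Module.End ℂ V} (h : LocN N s a b)
    (h' : LocN N s a b') : LocN N s a (b + b') := by
  intro m n
  have := congrArg₂ (· + ·) (h m n) (h' m n)
  simp only [add_zero, ← Finset.sum_add_distrib] at this
  rw [← this]
  refine Finset.sum_congr rfl fun k _ => ?_
  rw [← smul_add]
  congr 1
  simp only [Pi.add_apply, mul_add, add_mul, smul_add]
  abel

lemma LocN.smul {N : ℕ} {s : ℂ} {a b : ℤ → Module.End ℂ V} (h : LocN N s a b)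
    (c : ℂ) : LocN N s a (c • b) := by
  intro m n
  have := congrArg (fun X => c • X) (h m n)
  simp only [smul_zero, Finset.smul_sum] at this
  rw [← this]
  refine Finset.sum_congr rfl fun k _ => ?_
  rw [smul_comm c]
  congr 1
  simp only [Pi.smul_apply, mul_smul_comm, smul_mul_assoc, smul_sub]
  rw [smul_comm s]

/-- `(-1)^k` times the binomial coefficient of `n` over `k`. -/
def cb (k : ℕ) (n : ℤ) : ℂ := (-1) ^ k * ((Ring.choose n k : ℤ) : ℂ)

lemma cb_zero (n : ℤ) : cb 0 n = 1 := by simp [cb]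

lemma cb_succ (k : ℕ) (n : ℤ) : cb (k + 1) (n + 1) = cb (k + 1) n - cb k n := by
  simp only [cb, Ring.choose_succ_succ]
  push_cast
  ring

lemma cb_eq_zero {k : ℕ} {n : ℤ} (h0 : 0 ≤ n) (h : n < k) : cb k n = 0 := by
  obtain ⟨m, rfl⟩ := Int.eq_ofNat_of_zero_le h0
  have := Ring.choose_natCast (R := ℤ) m k
  rw [Nat.choose_eq_zero_of_lt (show m < k by omega)] at this
  rw [cb, this]
  simp

/-- Auxiliary form of the derivative on arrays. -/
def TT {W : Type*} [AddCommGroup W] [Module ℂ W] (k : ℕ) (K : ℤ × ℤ → W) : ℤ × ℤ → W :=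
  fun i => cb k i.1 • K (i.1 - k, i.2)

lemma TT_act {W : Type*} [AddCommGroup W] [Module ℂ W] (k : ℕ) :
    ∀ (N : ℕ) (K : ℤ × ℤ → W), act _ W (zw ^ N) K = 0 → act _ W (zw ^ (N + k)) (TT k K) = 0 := by
  induction k with
  | zero =>
    intro N K h
    have : TT 0 K = K := by ext i; simp [TT, cb_zero]
    rw [this]; exact h
  | succ k ihk =>
    intro N
    induction N with
    | zero =>
      intro K h
      have : K = 0 := by simpa using h
      subst this
      have : TT (k + 1) (0 : ℤ × ℤ → W) = 0 := by ext i; simp [TT]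
      rw [this, map_zero]
    | succ N ihN =>
      intro K h
      have key : act _ W zw (TT (k + 1) K) = TT (k + 1) (act _ W zw K) - TT k K := by
        ext ⟨m, n⟩
        simp only [act_dl, TT, Pi.sub_apply, Prod.mk_add_mk, add_zero, cb_succ]
        have e : m + 1 - ((k + 1 : ℕ) : ℤ) = m - k := by push_cast; ring
        have e' : m - ((k + 1 : ℕ) : ℤ) + 1 = m - k := by push_cast; ring
        rw [e, e', smul_sub, sub_smul]
        abel
      have h1 := ihN (act _ W zw K) (by
        rw [← Module.End.mul_apply, ← map_mul, ← pow_succ]; exact h)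
      have h2 := ihk (N + 1) K h
      rw [show N + 1 + (k + 1) = (N + (k + 1)) + 1 by ring, pow_succ, map_mul, Module.End.mul_apply,
        key, map_sub, h1, show N + (k + 1) = N + 1 + k by ring, h2, sub_zero]

lemma LocN.deriv {N : ℕ} {s : ℂ} {a b : ℤ → Module.End ℂ V} (h : LocN N s a b) (k : ℕ) :
    LocN (N + k) s (fun n => cb k n • a (n - k)) b := by
  rw [locN_iff] at *
  have := TT_act k N _ h
  convert this using 2
  ext i
  simp only [KK, TT, smul_mul_assoc, mul_smul_comm, smul_sub]
  rw [smul_comm s]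

/-! Parity, derivations and the vacuum -/

lemma tw_add (P : Module.End ℂ V) (hP : P * P = 1) (e f : ZMod 2) :
    tw P (e + f) = tw P e * tw P f := by
  rcases zmod2_cases e with rfl | rfl <;> rcases zmod2_cases f with rfl | rfl <;>
    simp [tw, hP, show (1 : ZMod 2) + 1 = 0 from rfl]

lemma cj_cj {P : Module.End ℂ V} (hP : P * P = 1) (e f : ZMod 2) (X : Module.End ℂ V) :
    cj P e (cj P f X) = cj P (e + f) X := by
  have h1 := tw_add P hP e f
  have h2 := tw_add P hP f e
  rw [add_comm] at h2
  calc cj P e (cj P f X) = (tw P e * tw P f) * X * (tw P f * tw P e) := by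
        simp only [cj, mul_assoc]
    _ = _ := by rw [← h1, ← h2]; rfl

/-- Conjugating a field by the parity involution. -/
def cjF (P : Module.End ℂ V) (e : ZMod 2) (B : Fld V) : Fld V :=
  ⟨fun n => cj P e (B.1 n), fun w => by
    obtain ⟨N, hN⟩ := B.2 (tw P e w)
    exact ⟨N, fun n hn => by simp [cj_apply, hN n hn]⟩⟩

lemma cjF_nop {P : Module.End ℂ V} (hP : P * P = 1) (d e f : ZMod 2) {a : Fld V} (ha : Hom P f a)
    (B : Fld V) : cjF P d (nop P e a B) = sg (d * f) • nop P e a (cjF P d B) := by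
  ext n w
  change cj P d ((nop P e a B).1 n) w = sg (d * f) • (nop P e a (cjF P d B)).1 n w
  have tt : ∀ v, tw P d (tw P d v) = v := fun v => by
    rw [← Module.End.mul_apply, tw_mul_self hP]; rfl
  rw [cj_apply, nop_apply, nop_apply, map_add, smul_add,
    ← fs_map (nop_ez1 a.1 B n _),
    ← fs_map (nop_ez2 a (fun m => cj P e (B.1 m)) n _),
    ← fs_smul (nop_ez1 a.1 (cjF P d B) n _),
    ← fs_smul (nop_ez2 a (fun m => cj P e ((cjF P d B).1 m)) n _)]
  have hh : ∀ m v, tw P d (a.1 m v) = sg (d * f) • a.1 m (tw P d v) := fun m v => by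
    have h := congrArg (fun X => X (tw P d v)) (ha d m)
    simp only [cj_apply, tt] at h
    exact h
  congr 1
  · congr 1; ext j
    rw [hh]; rfl
  · congr 1; ext j
    change _ = sg (d * f) • cj P e (cj P d (B.1 (n - 1 - j))) (a.1 j w)
    have h3 : a.1 j (tw P d w) = sg (d * f) • tw P d (a.1 j w) := by
      rw [hh, smul_smul, sg_mul_self, one_smul]
    rw [h3, map_smul, map_smul, cj_comm P e d]
    rfl

/-- Supercommutator of an odd operator `D` with a field. -/
def adD (P D : Module.End ℂ V) (B : Fld V) : Fld V :=
  ⟨fun n => D * B.1 n - cj P 1 (B.1 n) * D, fun w => by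
    obtain ⟨N, hN⟩ := B.2 w
    obtain ⟨M, hM⟩ := (cjF P 1 B).2 (D w)
    exact ⟨max N M, fun n hn => by
      have h1 := hM n (le_trans (le_max_right _ _) hn)
      change cj P 1 (B.1 n) (D w) = 0 at h1
      simp [hN n (le_trans (le_max_left _ _) hn), h1]⟩⟩

lemma adD_nop {P D : Module.End ℂ V} (hP : P * P = 1) (hD : ∀ e, cj P e D = sg e • D) (e : ZMod 2)
    {a : Fld V} (ha : Hom P e a) (B : Fld V) :
    adD P D (nop P e a B) = nop P (e + 1) (adD P D a) B + sg e • nop P e a (adD P D B) := by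
  ext n w
  have h1 : cj P 1 ((nop P e a B).1 n) = (cjF P 1 (nop P e a B)).1 n := rfl
  have ha1 : ∀ m, cj P 1 (a.1 m) = sg e • a.1 m := fun m => by rw [ha, one_mul]
  change D ((nop P e a B).1 n w) - cj P 1 ((nop P e a B).1 n) (D w)
    = (nop P (e + 1) (adD P D a) B).1 n w + sg e • (nop P e a (adD P D B)).1 n w
  rw [h1, cjF_nop hP 1 e e ha]
  change _ - sg (1 * e) • (nop P e a (cjF P 1 B)).1 n (D w) = _
  rw [one_mul]
  have z1 := nop_ez1 a.1 B n w
  have z2 := nop_ez2 a (fun m => cj P e (B.1 m)) n w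
  have z3 := nop_ez1 a.1 (cjF P 1 B) n (D w)
  have z4 := nop_ez2 a (fun m => cj P e ((cjF P 1 B).1 m)) n (D w)
  have z5 := nop_ez1 (adD P D a).1 B n w
  have z6 := nop_ez2 (adD P D a) (fun m => cj P (e + 1) (B.1 m)) n w
  have z7 := nop_ez1 a.1 (adD P D B) n w
  have z8 := nop_ez2 a (fun m => cj P e ((adD P D B).1 m)) n w
  simp only [nop_apply]
  rw [map_add, smul_add, smul_add, ← fs_map z1, ← fs_map z2, ← fs_smul z3, ← fs_smul z4,
    ← fs_smul z7, ← fs_smul z8]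
  have l : ∀ x y u v : V, x + y - (u + v) = (x - u) + (y - v) := fun x y u v => by abel
  have r : ∀ x y u v : V, x + y + (u + v) = (x + u) + (y + v) := fun x y u v => by abel
  rw [l, r, ← fs_sub (z1.map D) (z3.smul _), ← fs_sub (z2.map D) (z4.smul _),
    ← fs_add z5 (z7.smul _), ← fs_add z6 (z8.smul _)]
  congr 1
  · congr 1; ext j
    change D (a.1 _ (B.1 _ w)) - sg e • a.1 _ (cj P 1 (B.1 _) (D w))
      = (D (a.1 _ (B.1 _ w)) - cj P 1 (a.1 _) (D (B.1 _ w)))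
        + sg e • a.1 _ (D (B.1 _ w) - cj P 1 (B.1 _) (D w))
    rw [ha1, LinearMap.smul_apply, map_sub, smul_sub]
    abel
  · congr 1; ext j
    change D (cj P e (B.1 _) (a.1 j w)) - sg e • cj P e (cj P 1 (B.1 _)) (a.1 j (D w))
      = cj P (e + 1) (B.1 _) (D (a.1 j w) - cj P 1 (a.1 j) (D w))
        + sg e • (cj P e (D * B.1 _ - cj P 1 (B.1 _) * D)) (a.1 j w)
    have hcs : ∀ X Y : Module.End ℂ V, cj P e (X - Y) = cj P e X - cj P e Y := fun X Y => by
      simp [cj, mul_sub, sub_mul]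
    rw [hcs, cj_mul hP, cj_mul hP, hD, cj_cj hP, ha1]
    simp only [map_sub, LinearMap.sub_apply, LinearMap.smul_apply, Module.End.mul_apply, map_smul,
      smul_mul_assoc, mul_smul_comm, smul_sub, smul_smul, sg_mul_self, one_smul]
    abel

/-- The derivative of a field. -/
def dz (B : Fld V) : Fld V :=
  ⟨fun n => (-(n : ℂ)) • B.1 (n - 1), fun w => by
    obtain ⟨N, hN⟩ := B.2 w
    exact ⟨N + 1, fun n hn => by simp [hN (n - 1) (by omega)]⟩⟩

lemma dz_nop (P : Module.End ℂ V) (e : ZMod 2) (a B : Fld V) :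
    dz (nop P e a B) = nop P e (dz a) B + nop P e a (dz B) := by
  ext n w
  change (-(n : ℂ)) • (nop P e a B).1 (n - 1) w
    = (nop P e (dz a) B).1 n w + (nop P e a (dz B)).1 n w
  simp only [nop_apply]
  have r : ∀ x y u v : V, x + y + (u + v) = (x + u) + (y + v) := fun x y u v => by abel
  have z1 := nop_ez1 a.1 B (n - 1) w
  have z2 := nop_ez2 a (fun m => cj P e (B.1 m)) (n - 1) w
  have z5 := nop_ez1 (dz a).1 B n w
  have z6 := nop_ez2 (dz a) (fun m => cj P e (B.1 m)) n w
  have z7 := nop_ez1 a.1 (dz B) n w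
  have z8 := nop_ez2 a (fun m => cj P e ((dz B).1 m)) n w
  have z1' : EZ (fun j : ℕ => (j : ℂ) • a.1 (-1 - j) (B.1 (n - 1 + j) w)) := by
    obtain ⟨N, hN⟩ := z1
    exact ⟨N, fun j hj => by simp only [hN j hj, smul_zero]⟩
  have z2' : EZ (fun j : ℕ => (-(j : ℂ)) • cj P e (B.1 (n - 1 - j)) (a.1 (j - 1) w)) := by
    obtain ⟨N, hN⟩ := z6
    refine ⟨N, fun j hj => ?_⟩
    have := hN j hj
    simp only [dz, LinearMap.smul_apply, map_smul] at this
    simpa using this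
  rw [r, smul_add]
  congr 1
  · have e5 : ∑ᶠ j : ℕ, (dz a).1 (-1 - j) (B.1 (n + j) w)
        = ∑ᶠ j : ℕ, (j : ℂ) • a.1 (-1 - j) (B.1 (n - 1 + j) w) := by
      rw [fs_succ z1']
      simp only [Nat.cast_zero, zero_smul, zero_add]
      congr 1; ext j
      simp only [dz, LinearMap.smul_apply]
      have i1 : (-1 - (j : ℤ) - 1) = -1 - ((j + 1 : ℕ) : ℤ) := by push_cast; ring
      have i2 : n + (j : ℤ) = n - 1 + ((j + 1 : ℕ) : ℤ) := by push_cast; ring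
      rw [i1, i2]
      congr 1
      push_cast; ring
    rw [e5, ← fs_add z1' z7, ← fs_smul z1]
    congr 1; ext j
    simp only [dz, LinearMap.smul_apply, map_smul]
    rw [show n + (j : ℤ) - 1 = n - 1 + j by ring, ← add_smul]
    congr 1
    push_cast; ring
  · have e6 : ∑ᶠ j : ℕ, cj P e (B.1 (n - 1 - j)) ((dz a).1 j w)
        = ∑ᶠ j : ℕ, (-((j + 1 : ℕ) : ℂ)) • cj P e (B.1 (n - 1 - 1 - j)) (a.1 j w) := by
      have : ∑ᶠ j : ℕ, cj P e (B.1 (n - 1 - j)) ((dz a).1 j w)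
          = ∑ᶠ j : ℕ, (-(j : ℂ)) • cj P e (B.1 (n - 1 - j)) (a.1 (j - 1) w) := by
        congr 1; ext j
        simp [dz]
      rw [this, fs_succ z2']
      simp only [Nat.cast_zero, neg_zero, zero_smul, zero_add]
      congr 1; ext j
      have i1 : (((j + 1 : ℕ) : ℤ) - 1) = j := by push_cast; ring
      have i2 : n - 1 - ((j + 1 : ℕ) : ℤ) = n - 1 - 1 - j := by push_cast; ring
      rw [i1, i2]
    have z6' : EZ (fun j : ℕ => (-((j + 1 : ℕ) : ℂ)) • cj P e (B.1 (n - 1 - 1 - j)) (a.1 j w)) := by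
      obtain ⟨N, hN⟩ := z2
      exact ⟨N, fun j hj => by simp only [hN j hj, smul_zero]⟩
    rw [e6, ← fs_add z6' z8, ← fs_smul z2]
    congr 1; ext j
    simp only [dz, cj_smul, LinearMap.smul_apply]
    rw [show n - 1 - (j : ℤ) - 1 = n - 1 - 1 - j by ring, ← add_smul]
    congr 1
    push_cast; ring

lemma nop_vac (P : Module.End ℂ V) (e : ZMod 2) {a B : Fld V} {v : V}
    (ha : ∀ n, 0 ≤ n → a.1 n v = 0) (n : ℤ) :
    (nop P e a B).1 n v = ∑ᶠ j : ℕ, a.1 (-1 - j) (B.1 (n + j) v) := by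
  rw [nop_apply]
  have : ∀ j : ℕ, cj P e (B.1 (n - 1 - j)) (a.1 j v) = 0 := fun j => by
    rw [ha j (by omega), map_zero]
  simp [this]

lemma half_neg (x y : V) : (1 / 2 : ℂ) • (x - y) = (-1 : ℂ) • ((1 / 2 : ℂ) • (y - x)) := by
  rw [smul_smul, ← neg_sub y x, smul_neg, ← neg_smul]
  congr 1; ring

lemma add_neg_smul (x : V) : x + (-1 : ℂ) • x = 0 := by simp

lemma succ_cb (k : ℕ) (n : ℤ) : ((k : ℂ) + 1) * cb (k + 1) n = -((n : ℂ) - k) * cb k n := by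
  have h := Ring.choose_smul_choose (R := ℤ) n (show k ≤ k + 1 by omega)
  rw [Nat.choose_succ_self_right, show k + 1 - k = 1 by omega, Ring.choose_one_right] at h
  have h2 := congrArg (fun x : ℤ => (x : ℂ)) h
  simp only [nsmul_eq_mul] at h2
  push_cast at h2
  simp only [cb, pow_succ]
  linear_combination (-(-1 : ℂ) ^ k) * h2

lemma succ_cb' (k : ℕ) (n : ℤ) : ((k : ℂ) + 1) * cb (k + 1) n = -(n : ℂ) * cb k (n - 1) := by
  have h := cb_succ k (n - 1)
  have h2 := succ_cb k (n - 1)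
  rw [sub_add_cancel] at h
  rw [h, mul_sub, h2]
  push_cast
  ring

lemma cb_neg_one (k : ℕ) : cb k (-1) = 1 := by
  induction k with
  | zero => exact cb_zero _
  | succ k ih =>
    have h := cb_succ k (-1)
    rw [neg_add_cancel, cb_eq_zero le_rfl (by omega), ih] at h
    linear_combination -h

lemma nop_smul_left (P : Module.End ℂ V) (e : ZMod 2) (c : ℂ) (a B : Fld V) :
    nop P e (c • a) B = c • nop P e a B := by
  ext n w
  change (nop P e (c • a) B).1 n w = c • (nop P e a B).1 n w
  rw [nop_apply, nop_apply, smul_add, ← fs_smul (nop_ez1 a.1 B n w),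
    ← fs_smul (nop_ez2 a (fun m => cj P e (B.1 m)) n w)]
  simp

lemma adD_add (P D : Module.End ℂ V) (B C : Fld V) : adD P D (B + C) = adD P D B + adD P D C := by
  ext n w
  simp only [adD, Submodule.coe_add, Pi.add_apply, cj_add, mul_add, add_mul, LinearMap.sub_apply,
    LinearMap.add_apply]
  abel

lemma adD_smul (P D : Module.End ℂ V) (c : ℂ) (B : Fld V) : adD P D (c • B) = c • adD P D B := by
  ext n w
  simp only [adD, Submodule.coe_smul, Pi.smul_apply, cj_smul, mul_smul_comm, smul_mul_assoc,
    smul_sub]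

lemma dz_add (B C : Fld V) : dz (B + C) = dz B + dz C := by
  ext n w
  simp [dz]

lemma dz_smul (c : ℂ) (B : Fld V) : dz (c • B) = c • dz B := by
  ext n w
  simp only [dz, Submodule.coe_smul, Pi.smul_apply]
  rw [smul_comm]

lemma alg_aux (a b c d e : V) (k : ℂ) :
    a + (b + c) - (k • d + b + (a + e)) = (-k) • d + (c - e) := by
  rw [neg_smul]; abel

lemma smul_sub_smul (c s : ℂ) (x y : V) : c • x - s • c • y = c • (x - s • y) := by
  rw [smul_comm, smul_sub]

lemma sub_self_aux (x : V) : x - x = 0 := sub_self x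

lemma zero_sub_zero_aux : (0 : V) - 0 = 0 := sub_zero 0

end Fields

/-! ### Free supercommutative algebras -/

section Super

variable {G : Type*} (π : G → ZMod 2)

/-- Supercommutativity of the generators: `x y = (-1)^(p(x) p(y)) y x`. -/
inductive SuperRel : FreeAlgebra ℂ G → FreeAlgebra ℂ G → Prop
  | swap (g h : G) : SuperRel (FreeAlgebra.ι ℂ g * FreeAlgebra.ι ℂ h)
      (sg (π g * π h) • (FreeAlgebra.ι ℂ h * FreeAlgebra.ι ℂ g))

/-- The free supercommutative algebra on generators `g` of parity `π g` (the symmetric algebra of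
the superspace with basis `G`). -/
abbrev SAlg : Type _ := RingQuot (SuperRel π)

/-- The generators. -/
def X (g : G) : SAlg π := RingQuot.mkAlgHom ℂ (SuperRel π) (FreeAlgebra.ι ℂ g)

lemma X_swap (g h : G) : X π g * X π h = sg (π g * π h) • (X π h * X π g) := by
  have := RingQuot.mkAlgHom_rel ℂ (SuperRel.swap (π := π) g h)
  simpa [X] using this

variable {π}

/-- The universal property of the free supercommutative algebra. -/
def lift {B : Type*} [Semiring B] [Algebra ℂ B] (f : G → B)
    (hf : ∀ g h, f g * f h = sg (π g * π h) • (f h * f g)) : SAlg π →ₐ[ℂ] B :=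
  RingQuot.liftAlgHom ℂ ⟨FreeAlgebra.lift ℂ f, by
    rintro _ _ ⟨g, h⟩
    simp [hf g h]⟩

@[simp] lemma lift_X {B : Type*} [Semiring B] [Algebra ℂ B] (f : G → B)
    (hf : ∀ g h, f g * f h = sg (π g * π h) • (f h * f g)) (g : G) : lift f hf (X π g) = f g := by
  simp [lift, X]

lemma SAlg.ind {motive : SAlg π → Prop} (one : motive 1)
    (mul : ∀ g v, motive v → motive (X π g * v))
    (add : ∀ u v, motive u → motive v → motive (u + v))
    (smul : ∀ (c : ℂ) v, motive v → motive (c • v)) (v : SAlg π) : motive v := by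
  obtain ⟨x, rfl⟩ := RingQuot.mkAlgHom_surjective ℂ (SuperRel π) v
  suffices h : ∀ x : FreeAlgebra ℂ G, ∀ v : SAlg π, motive v →
      motive (RingQuot.mkAlgHom ℂ (SuperRel π) x * v) by
    simpa using h x 1 one
  intro x
  induction x with
  | grade0 r =>
    intro v hv
    rw [AlgHom.commutes, ← Algebra.smul_def]
    exact smul r v hv
  | grade1 g => exact fun v hv => mul g v hv
  | mul a b ha hb =>
    intro v hv
    rw [map_mul, mul_assoc]
    exact ha _ (hb _ hv)
  | add a b ha hb =>
    intro v hv
    rw [map_add, add_mul]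
    exact add _ _ (ha _ hv) (hb _ hv)

variable (π) in
/-- The parity involution. -/
def par : SAlg π →ₐ[ℂ] SAlg π := lift (fun g => sg (π g) • X π g) (fun g h => by
  simp only [smul_mul_smul_comm, smul_smul]
  rw [X_swap, smul_smul]
  congr 1
  ring)

@[simp] lemma par_X (g : G) : par π (X π g) = sg (π g) • X π g := by simp [par]

variable (π) in
/-- The parity involution as an endomorphism. -/
def PP : Module.End ℂ (SAlg π) := (par π).toLinearMap

lemma PP_apply (v : SAlg π) : PP π v = par π v := rfl

lemma par_par (v : SAlg π) : par π (par π v) = v := by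
  induction v using SAlg.ind with
  | one => simp
  | mul g v h => simp [h, smul_smul, sg_mul_self]
  | add u v hu hv => simp [hu, hv]
  | smul c v h => simp [h]

lemma PP_sq : PP π * PP π = 1 := by
  ext v; exact par_par v

variable (π) in
/-- The part of parity `i`. -/
def gr (i : ZMod 2) : Submodule ℂ (SAlg π) where
  carrier := {v | par π v = sg i • v}
  zero_mem' := by simp
  add_mem' := by
    intro a b ha hb
    simp only [Set.mem_ofPred_eq] at *
    rw [map_add, ha, hb, smul_add]
  smul_mem' := by
    intro c a ha
    simp only [Set.mem_ofPred_eq] at *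
    rw [map_smul, ha, smul_comm]

lemma mem_gr {i : ZMod 2} {v : SAlg π} : v ∈ gr π i ↔ par π v = sg i • v := Iff.rfl

lemma gr_internal : DirectSum.IsInternal (gr π) := by
  have hne : (0 : ZMod 2) ≠ 1 := by decide
  have huniv : (Set.univ : Set (ZMod 2)) = {0, 1} := by
    ext i; rcases zmod2_cases i with rfl | rfl <;> simp
  rw [DirectSum.isInternal_submodule_iff_isCompl _ hne huniv]
  refine ⟨?_, ?_⟩
  · rw [Submodule.disjoint_def]
    intro v h0 h1
    rw [mem_gr] at h0 h1
    rw [h0] at h1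
    simp only [sg_zero, one_smul, sg_one] at h1
    have h2 : (2 : ℂ) • v = 0 := by
      rw [two_smul]; exact eq_neg_iff_add_eq_zero.mp (h1.trans (neg_one_smul ℂ v))
    exact (smul_eq_zero.mp h2).resolve_left two_ne_zero
  · rw [codisjoint_iff, eq_top_iff]
    intro v _
    rw [Submodule.mem_sup]
    refine ⟨(1 / 2 : ℂ) • (v + par π v), ?_, (1 / 2 : ℂ) • (v - par π v), ?_, ?_⟩
    · rw [mem_gr]; simp [par_par, add_comm]
    · rw [mem_gr, map_smul, map_sub, par_par, sg_one]
      exact half_neg _ _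
    · rw [← smul_add, add_add_sub_cancel, ← two_smul ℂ v, smul_smul]; norm_num

/-- Left superderivations: the pair `(v, d v)` under multiplication by a generator. -/
def sderAux (e : ZMod 2) (f : G → SAlg π) (g : G) : Module.End ℂ (SAlg π × SAlg π) where
  toFun p := (X π g * p.1, f g * p.1 + sg (e * π g) • (X π g * p.2))
  map_add' p q := by
    ext
    · simp [mul_add]
    · simp only [Prod.snd_add, Prod.fst_add, mul_add, smul_add]; abel
  map_smul' c p := by
    ext
    · simp
    · simp [smul_comm c]

/-- A map of parity `e` from the generators to the algebra. -/
def Par (e : ZMod 2) (f : G → SAlg π) : Prop :=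
  ∀ g h, f g * X π h = sg ((e + π g) * π h) • (X π h * f g)

lemma sderAux_comm {e : ZMod 2} {f : G → SAlg π} (hf : Par e f) (g h : G) :
    sderAux e f g * sderAux e f h = sg (π g * π h) • (sderAux e f h * sderAux e f g) := by
  apply LinearMap.ext
  rintro ⟨u, v⟩
  have hgh := X_swap π g h
  have s1 := sg_mul_self (π g * π h)
  ext
  · simp only [Module.End.mul_apply, sderAux, LinearMap.coe_mk, AddHom.coe_mk,
      LinearMap.smul_apply, Prod.smul_fst]
    rw [← mul_assoc, hgh, smul_mul_assoc, mul_assoc]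
  · simp only [Module.End.mul_apply, sderAux, LinearMap.coe_mk, AddHom.coe_mk,
      LinearMap.smul_apply, Prod.smul_snd]
    have a1 : f g * (X π h * u) = sg ((e + π g) * π h) • (X π h * (f g * u)) := by
      rw [← mul_assoc, hf g h, smul_mul_assoc, mul_assoc]
    have a2 : f h * (X π g * u) = sg ((e + π h) * π g) • (X π g * (f h * u)) := by
      rw [← mul_assoc, hf h g, smul_mul_assoc, mul_assoc]
    have a3 : X π g * (X π h * v) = sg (π g * π h) • (X π h * (X π g * v)) := by
      rw [← mul_assoc, hgh, smul_mul_assoc, mul_assoc]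
    rw [a1, a2, mul_add, mul_add, mul_smul_comm, mul_smul_comm, a3]
    simp only [smul_add, smul_smul, add_mul, sg_add]
    have t1 : sg (π g * π h) * (sg (e * π g) * sg (π h * π g)) = sg (e * π g) := by
      rw [mul_comm (π h)]; linear_combination sg (e * π g) * s1
    have t2 : sg (e * π g) * (sg (e * π h) * sg (π g * π h))
      = sg (π g * π h) * (sg (e * π h) * sg (e * π g)) := by ring
    have t3 : sg (e * π h) * sg (π g * π h) = sg (π g * π h) * sg (e * π h) := by ring
    rw [t1, t2, t3]
    abel

/-- The left superderivation of parity `e` with given values on the generators. -/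
def sder (e : ZMod 2) (f : G → SAlg π) (hf : Par e f) : Module.End ℂ (SAlg π) where
  toFun v := (lift (sderAux e f) (sderAux_comm hf) v (1, 0)).2
  map_add' u v := by simp
  map_smul' c v := by simp

lemma sder_fst {e : ZMod 2} {f : G → SAlg π} (hf : Par e f) (v : SAlg π) :
    (lift (sderAux e f) (sderAux_comm hf) v (1, 0)).1 = v := by
  induction v using SAlg.ind with
  | one => simp
  | mul g v h =>
    rw [map_mul, lift_X, Module.End.mul_apply]
    simp only [sderAux, LinearMap.coe_mk, AddHom.coe_mk]
    rw [h]
  | add u v hu hv => simp [hu, hv]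
  | smul c v h => simp [h]

@[simp] lemma sder_one {e : ZMod 2} {f : G → SAlg π} (hf : Par e f) : sder e f hf 1 = 0 := by
  simp [sder]

lemma sder_mul {e : ZMod 2} {f : G → SAlg π} (hf : Par e f) (g : G) (v : SAlg π) :
    sder e f hf (X π g * v) = f g * v + sg (e * π g) • (X π g * sder e f hf v) := by
  have := sder_fst hf v
  simp only [sder, LinearMap.coe_mk, AddHom.coe_mk, map_mul, lift_X, Module.End.mul_apply]
  conv_lhs => rw [sderAux]
  simp only [LinearMap.coe_mk, AddHom.coe_mk]
  rw [this]

/-- Two operators obeying the same product rule agree. -/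
lemma op_ext {e : ZMod 2} {S T : Module.End ℂ (SAlg π)} {f : G → SAlg π} (h1 : S 1 = T 1)
    (hS : ∀ g v, S (X π g * v) = f g * v + sg (e * π g) • (X π g * S v))
    (hT : ∀ g v, T (X π g * v) = f g * v + sg (e * π g) • (X π g * T v)) : S = T := by
  ext v
  induction v using SAlg.ind with
  | one => exact h1
  | mul g v h => rw [hS, hT, h]
  | add u v hu hv => rw [map_add, map_add, hu, hv]
  | smul c v h => rw [map_smul, map_smul, h]

end Super

/-! ### The SUSY charged free fermion vertex algebra -/

section Fermion

variable {A : Type*}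

/-- The symbols `φ_a` (`Sum.inl a`) and `φ^ā` (`Sum.inr a`) for `a` in the basis `A`. -/
abbrev Base (A : Type*) := A ⊕ A

/-- Parities: `φ_a` has the parity of `a`, and `φ^ā` the opposite one. -/
def bpar (p : A → ZMod 2) : Base A → ZMod 2
  | Sum.inl a => p a
  | Sum.inr a => p a + 1

/-- The triple `(s, d, k)` stands for `∂^k D^d s / k!`: a basis of `ℂ[∂, D] ⊗ (φ_U ⊕ φ^Ū)`. -/
abbrev Gen (A : Type*) := Base A × ZMod 2 × ℕ

def gpar (p : A → ZMod 2) (g : Gen A) : ZMod 2 := bpar p g.1 + g.2.1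

lemma bpar_swap (p : A → ZMod 2) (s : Base A) : bpar p s.swap = bpar p s + 1 := by
  rcases s with a | a
  · rfl
  · change p a = p a + 1 + 1
    rw [add_assoc, show (1 : ZMod 2) + 1 = 0 from rfl, add_zero]

variable (p : A → ZMod 2)

/-- The underlying superspace: the free supercommutative algebra on `ℂ[∂, D] ⊗ (φ_U ⊕ φ^Ū)`. -/
abbrev Fock := SAlg (gpar p)

open Classical in
lemma par_delta (h : Gen A) :
    Par (π := gpar p) (gpar p h) (fun g => if g = h then 1 else 0) := by
  intro g g'
  by_cases hg : g = h
  · subst hg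
    have : gpar p g + gpar p g = 0 := by
      rcases zmod2_cases (gpar p g) with h | h <;> rw [h] <;> rfl
    simp [this]
  · simp [hg]

open Classical in
/-- The derivative with respect to the generator `h`. -/
def pd (h : Gen A) : Module.End ℂ (Fock p) :=
  sder (gpar p h) (fun g => if g = h then 1 else 0) (par_delta p h)

/-- The `n`-th mode of the field of `D^d s`, where `d ∈ {0, 1}`; thus it is `s_(n|1-d)`. For `n < 0`
it is the multiplication by `∂^(-1-n) D^d s / (-1-n)!`, and for `n ≥ 0` it is a superderivation. These
modes are the ones given by `[φ_a _Λ φ^b̄] = [φ^b̄ _Λ φ_a] = δ_{ab}`, that is, by the only nonzero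
supercommutators `[(Ds)_(m), s'_(n)] = δ_{m+n,-1}` and
`[s_(m), (Ds')_(n)] = (-1)^(p(s)+1) δ_{m+n,-1}`, where `{s, s'} = {φ_a, φ^ā}`. -/
def xm (s : Base A) (d : ZMod 2) : ℤ → Module.End ℂ (Fock p)
  | Int.ofNat n => sg ((d + 1) * (bpar p s + 1)) • pd p (s.swap, d + 1, n)
  | Int.negSucc n => LinearMap.mulLeft ℂ (X (gpar p) (s, d, n))

lemma pd_one (h : Gen A) : pd p h 1 = 0 := sder_one _

open Classical in
lemma pd_mul (h g : Gen A) (v : Fock p) : pd p h (X _ g * v)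
    = (if g = h then (1 : ℂ) else 0) • v + sg (gpar p h * gpar p g) • (X _ g * pd p h v) := by
  rw [pd, sder_mul]
  by_cases hg : g = h <;> simp [hg]

lemma pd_field (s : Base A) (d : ZMod 2) (v : Fock p) :
    ∃ N : ℕ, ∀ k, N ≤ k → pd p (s, d, k) v = 0 := by
  induction v using SAlg.ind with
  | one => exact ⟨0, fun k _ => pd_one p _⟩
  | mul g v h =>
    obtain ⟨N, hN⟩ := h
    refine ⟨max N (g.2.2 + 1), fun k hk => ?_⟩
    have hg : g ≠ (s, d, k) := by
      rintro rfl
      have := le_trans (le_max_right _ _) hk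
      simp at this
    simp [pd_mul, hg, hN k (le_trans (le_max_left _ _) hk)]
  | add u v hu hv =>
    obtain ⟨N, hN⟩ := hu
    obtain ⟨M, hM⟩ := hv
    exact ⟨max N M, fun k hk => by
      rw [map_add, hN k (le_trans (le_max_left _ _) hk), hM k (le_trans (le_max_right _ _) hk),
        add_zero]⟩
  | smul c v h =>
    obtain ⟨N, hN⟩ := h
    exact ⟨N, fun k hk => by rw [map_smul, hN k hk, smul_zero]⟩

lemma xm_field (s : Base A) (d : ZMod 2) (v : Fock p) :
    ∃ N : ℤ, ∀ n, N ≤ n → xm p s d n v = 0 := by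
  obtain ⟨N, hN⟩ := pd_field p s.swap (d + 1) v
  refine ⟨N, fun n hn => ?_⟩
  obtain ⟨k, rfl⟩ := Int.eq_ofNat_of_zero_le (le_trans (by omega) hn)
  change sg _ • pd p _ v = 0
  rw [hN k (by omega), smul_zero]

lemma xm_neg (s : Base A) (d : ZMod 2) (n : ℕ) (v : Fock p) :
    xm p s d (-1 - n) v = X _ (s, d, n) * v := by
  rw [show (-1 : ℤ) - n = Int.negSucc n by rw [Int.negSucc_eq]; ring]; rfl

lemma xm_nonneg (s : Base A) (d : ZMod 2) (n : ℕ) (v : Fock p) :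
    xm p s d n v = sg ((d + 1) * (bpar p s + 1)) • pd p (s.swap, d + 1, n) v := rfl

/-- The field of the generator `g = ∂^k D^d s / k!`. -/
def fld (g : Gen A) : Fld (Fock p) :=
  ⟨fun n => cb g.2.2 n • xm p g.1 g.2.1 (n - g.2.2), fun w => by
    obtain ⟨N, hN⟩ := xm_field p g.1 g.2.1 w
    exact ⟨N + g.2.2, fun n hn => by simp [hN (n - g.2.2) (by omega)]⟩⟩

lemma gpar_dual (s : Base A) (d : ZMod 2) (k : ℕ) :
    gpar p (s.swap, d + 1, k) = bpar p s + d := by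
  rw [gpar, bpar_swap]
  change bpar p s + 1 + (d + 1) = _
  rw [show bpar p s + 1 + (d + 1) = bpar p s + d + (1 + 1) by ring, show (1 : ZMod 2) + 1 = 0 from rfl,
    add_zero]

lemma pd_par (h : Gen A) (v : Fock p) :
    par _ (pd p h (par _ v)) = sg (gpar p h) • pd p h v := by
  induction v using SAlg.ind with
  | one => simp [pd_one]
  | mul g v ih =>
    rw [map_mul, par_X, smul_mul_assoc, map_smul, map_smul, pd_mul, pd_mul]
    simp only [map_add, map_smul, map_mul, par_X, par_par, smul_add, smul_mul_assoc, ih,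
      mul_smul_comm, smul_smul]
    congr 1
    · by_cases hg : g = h
      · rw [hg]
      · simp [hg]
    · congr 1
      have := sg_mul_self (gpar p g)
      linear_combination (sg (gpar p h * gpar p g) * sg (gpar p h)) * this
  | add u v hu hv => simp only [map_add, smul_add, hu, hv]
  | smul c v h => simp only [map_smul, h]; rw [smul_comm]

lemma cj_of_par {e : ZMod 2} {S : Module.End ℂ (Fock p)}
    (h : ∀ v, par _ (S (par _ v)) = sg e • S v) (d : ZMod 2) : cj (PP _) d S = sg (d * e) • S := by
  rcases zmod2_cases d with rfl | rfl
  · simp [cj, tw]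
  · ext v
    rw [one_mul, cj_apply]
    exact h v

lemma xm_par (s : Base A) (d : ZMod 2) (n : ℤ) (e : ZMod 2) :
    cj (PP _) e (xm p s d n) = sg (e * (bpar p s + d)) • xm p s d n := by
  refine cj_of_par p (fun v => ?_) e
  rcases n with n | n
  · change par _ (xm p s d n (par _ v)) = _ • xm p s d n v
    rw [xm_nonneg, xm_nonneg, map_smul, pd_par, gpar_dual, smul_comm]
  · change par _ (X _ (s, d, n) * par _ v) = _ • (X _ (s, d, n) * v)
    rw [map_mul, par_par, par_X, smul_mul_assoc]
    rfl

lemma fld_hom (g : Gen A) : Hom (PP (gpar p)) (gpar p g) (fld p g) := by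
  intro e n
  change cj _ e (cb _ _ • xm p _ _ _) = _ • (cb _ _ • xm p _ _ _)
  rw [cj_smul, xm_par, smul_comm]
  rfl

lemma pd_pd (h h' : Gen A) (v : Fock p) :
    pd p h (pd p h' v) = sg (gpar p h * gpar p h') • pd p h' (pd p h v) := by
  classical
  have hs := sg_mul_self (gpar p h * gpar p h')
  induction v using SAlg.ind with
  | one => simp [pd_one]
  | mul g v ih =>
    rw [pd_mul, pd_mul]
    simp only [map_add, map_smul]
    rw [pd_mul, pd_mul]
    simp only [smul_add, smul_smul, ih, mul_smul_comm]
    have c1 : sg (gpar p h' * gpar p g) * (if g = h then (1 : ℂ) else 0)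
        = sg (gpar p h * gpar p h') * (if g = h then (1 : ℂ) else 0) := by
      by_cases hg : g = h
      · rw [hg, mul_comm (gpar p h')]
      · simp [hg]
    have c2 : sg (gpar p h * gpar p h') * sg (gpar p h * gpar p g) * (if g = h' then (1 : ℂ) else 0)
        = (if g = h' then (1 : ℂ) else 0) := by
      by_cases hg : g = h'
      · rw [hg, hs, one_mul]
      · simp [hg]
    rw [c1, ← mul_assoc (sg (gpar p h * gpar p h')), c2]
    rw [show sg (gpar p h * gpar p h') * (sg (gpar p h * gpar p g) * sg (gpar p h' * gpar p g))
      = sg (gpar p h' * gpar p g) * (sg (gpar p h * gpar p g) * sg (gpar p h * gpar p h')) by ring]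
    abel
  | add u v hu hv => simp only [map_add, smul_add, hu, hv]
  | smul c v h => simp only [map_smul, h]; rw [smul_comm]

/-- Supercommutator of the modes. -/
lemma xm_comm (s s' : Base A) (d d' : ZMod 2) (m n : ℤ) :
    xm p s d m * xm p s' d' n
      - sg ((bpar p s + d) * (bpar p s' + d')) • (xm p s' d' n * xm p s d m)
      = (open Classical in if m + n = -1 ∧ s' = s.swap ∧ d' = d + 1
          then sg ((d + 1) * (bpar p s + 1)) else 0) • 1 := by
  classical
  have two : (1 : ZMod 2) + 1 = 0 := rfl
  have hs := sg_mul_self ((bpar p s + d) * (bpar p s' + d'))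
  ext v
  simp only [LinearMap.sub_apply, LinearMap.smul_apply, Module.End.mul_apply, Module.End.one_apply]
  rcases m with m | m <;> rcases n with n | n
  · change xm p s d m (xm p s' d' n v) - _ • xm p s' d' n (xm p s d m v) = _
    rw [if_neg (by rintro ⟨h, -⟩; simp only [Int.ofNat_eq_natCast] at h; omega), zero_smul]
    simp only [xm_nonneg, map_smul]
    rw [pd_pd, gpar_dual, gpar_dual, smul_smul, smul_smul, smul_smul, smul_smul, ← sub_smul]
    rw [show ∀ x y z : ℂ, x * y * z - z * y * x = 0 from fun x y z => by ring, zero_smul]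
  · change xm p s d m (X _ (s', d', n) * v) - _ • (X _ (s', d', n) * xm p s d m v) = _
    rw [xm_nonneg, xm_nonneg, pd_mul, gpar_dual, smul_add, mul_smul_comm, smul_smul, smul_smul,
      smul_smul]
    change _ + (_ * sg ((bpar p s + d) * (bpar p s' + d'))) • _ - _ = _
    rw [mul_comm (sg ((bpar p s + d) * (bpar p s' + d')))]
    rw [add_sub_cancel_right]
    congr 1
    have : ((s', d', n) = (s.swap, d + 1, m)) ↔
        (Int.ofNat m + Int.negSucc n = -1 ∧ s' = s.swap ∧ d' = d + 1) := by
      rw [Prod.mk.injEq, Prod.mk.injEq, Int.negSucc_eq, Int.ofNat_eq_natCast]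
      constructor
      · rintro ⟨h1, h2, h3⟩; exact ⟨by omega, h1, h2⟩
      · rintro ⟨h1, h2, h3⟩; exact ⟨h2, h3, by omega⟩
    simp only [this, mul_ite, mul_one, mul_zero]
  · change X _ (s, d, m) * xm p s' d' n v - _ • xm p s' d' n (X _ (s, d, m) * v) = _
    rw [xm_nonneg, xm_nonneg, pd_mul, gpar_dual, smul_add, smul_add, mul_smul_comm]
    simp only [smul_smul]
    change _ - (_ + (_ * (_ * sg ((bpar p s' + d') * (bpar p s + d)))) • _) = _
    rw [mul_comm (bpar p s' + d')]
    rw [show ∀ x y : ℂ, x * (y * x) = y * (x * x) from fun x y => by ring, hs, mul_one]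
    rw [sub_add_cancel_right, ← neg_smul]
    congr 1
    have : ((s, d, m) = (s'.swap, d' + 1, n)) ↔
        (Int.negSucc m + Int.ofNat n = -1 ∧ s' = s.swap ∧ d' = d + 1) := by
      rw [Prod.mk.injEq, Prod.mk.injEq, Int.negSucc_eq, Int.ofNat_eq_natCast]
      constructor
      · rintro ⟨h1, h2, h3⟩
        refine ⟨by omega, by rw [h1]; simp, by rw [h2, add_assoc, two, add_zero]⟩
      · rintro ⟨h1, h2, h3⟩
        exact ⟨by rw [h2]; simp, by rw [h3, add_assoc, two, add_zero], by omega⟩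
    simp only [this]
    split_ifs with hc
    · obtain ⟨-, rfl, rfl⟩ := hc
      rw [bpar_swap]
      rcases zmod2_cases d with rfl | rfl <;> rcases zmod2_cases (bpar p s) with h | h <;>
        simp [h, two]
    · simp
  · change X _ (s, d, m) * (X _ (s', d', n) * v) - _ • (X _ (s', d', n) * (X _ (s, d, m) * v)) = _
    rw [if_neg (by rintro ⟨h, -⟩; rw [Int.negSucc_eq, Int.negSucc_eq] at h; omega), zero_smul,
      ← mul_assoc, X_swap, smul_mul_assoc, mul_assoc]
    exact sub_self _

lemma xm_loc (s s' : Base A) (d d' : ZMod 2) :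
    LocN 1 (sg ((bpar p s + d) * (bpar p s' + d'))) (xm p s d) (xm p s' d') := by
  intro m n
  simp only [xm_comm]
  rw [Finset.sum_range_succ, Finset.sum_range_one]
  have e1 : m + ((1 : ℕ) : ℤ) - ((0 : ℕ) : ℤ) + (n + ((0 : ℕ) : ℤ)) = m + n + 1 := by
    push_cast; ring
  have e2 : m + ((1 : ℕ) : ℤ) - ((1 : ℕ) : ℤ) + (n + ((1 : ℕ) : ℤ)) = m + n + 1 := by
    push_cast; ring
  rw [e1, e2]
  simp only [pow_zero, Nat.choose_zero_right, Nat.cast_one, mul_one, one_smul, pow_one,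
    Nat.choose_self]
  exact add_neg_smul (V := Module.End ℂ (Fock p)) _

lemma fld_loc (g h : Gen A) : ∃ N, LocN N (sg (gpar p g * gpar p h)) (fld p g).1 (fld p h).1 := by
  have h1 := (xm_loc p g.1 h.1 g.2.1 h.2.1).deriv g.2.2
  have h2 := (h1.symm (sg_mul_self _)).deriv h.2.2
  exact ⟨_, h2.symm (sg_mul_self _)⟩

lemma fld_neg (g : Gen A) (n : ℤ) (hn : n < 0) :
    ∃ (c : ℂ) (h : Gen A), gpar p h = gpar p g ∧
      (fld p g).1 n = c • LinearMap.mulLeft ℂ (X (gpar p) h) := by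
  refine ⟨cb g.2.2 n, (g.1, g.2.1, (g.2.2 - n - 1).toNat), rfl, ?_⟩
  change _ • xm p _ _ _ = _
  congr 1
  ext v
  rw [show n - g.2.2 = -1 - ((g.2.2 - n - 1).toNat : ℤ) by
    rw [Int.toNat_of_nonneg (by omega)]; ring, xm_neg]
  rfl

lemma fld_nonneg (g : Gen A) (n : ℤ) (hn : 0 ≤ n) :
    ∃ (c : ℂ) (h : Gen A), gpar p h = gpar p g ∧ (fld p g).1 n = c • pd p h := by
  by_cases hk : n < g.2.2
  · refine ⟨0, g, rfl, ?_⟩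
    change cb _ _ • _ = _
    rw [cb_eq_zero hn hk, zero_smul, zero_smul]
  · refine ⟨cb g.2.2 n * sg ((g.2.1 + 1) * (bpar p g.1 + 1)),
      (g.1.swap, g.2.1 + 1, (n - g.2.2).toNat), gpar_dual p _ _ _, ?_⟩
    change _ • xm p _ _ _ = _
    rw [mul_smul]
    congr 1
    ext v
    rw [show n - g.2.2 = ((n - g.2.2).toNat : ℤ) by rw [Int.toNat_of_nonneg (by omega)], xm_nonneg]
    rfl

lemma fld_comm (g h : Gen A) :
    nop (PP (gpar p)) (gpar p g) (fld p g) * nop (PP (gpar p)) (gpar p h) (fld p h)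
      = sg (gpar p g * gpar p h) •
        (nop (PP (gpar p)) (gpar p h) (fld p h) * nop (PP (gpar p)) (gpar p g) (fld p g)) := by
  refine nop_comm _ PP_sq _ _ _ _ (fld_hom p g) (fld_hom p h) ?_ ?_
  · intro i j hi hj
    obtain ⟨c, g', hg, e1⟩ := fld_neg p g i hi
    obtain ⟨c', h', hh, e2⟩ := fld_neg p h j hj
    rw [e1, e2, ← hg, ← hh]
    ext v
    simp only [LinearMap.smul_apply, Module.End.mul_apply, LinearMap.mulLeft_apply, map_smul]
    rw [← mul_assoc, X_swap, smul_mul_assoc, mul_assoc]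
    simp only [smul_smul]
    congr 1
    ring
  · intro i j hi hj
    obtain ⟨c, g', hg, e1⟩ := fld_nonneg p g i hi
    obtain ⟨c', h', hh, e2⟩ := fld_nonneg p h j hj
    rw [e1, e2, ← hg, ← hh]
    ext v
    simp only [LinearMap.smul_apply, Module.End.mul_apply, map_smul]
    rw [pd_pd]
    simp only [smul_smul]
    congr 1
    ring

/-- The field of the vacuum. -/
def idF : Fld (Fock p) := ⟨fun n => if n = -1 then 1 else 0, fun w => ⟨0, fun n hn => by
  have : ¬ n = -1 := by omega
  simp [this]⟩⟩

/-- The (non-super) state-field correspondence, determined by `Y(1) = id` and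
`Y(g v) = :Y(g) Y(v):` for the generators `g`. -/
def YY : Fock p →ₗ[ℂ] Fld (Fock p) where
  toFun v := lift (fun g => nop (PP (gpar p)) (gpar p g) (fld p g)) (fld_comm p) v (idF p)
  map_add' u v := by simp
  map_smul' c v := by simp

lemma YY_one : YY p 1 = idF p := by simp [YY]

lemma YY_mul (g : Gen A) (v : Fock p) :
    YY p (X _ g * v) = nop (PP (gpar p)) (gpar p g) (fld p g) (YY p v) := by
  simp [YY]

/-! The odd endomorphism `D` -/

/-- `D g = dc g • dg g` -/
def dc (g : Gen A) : ℂ := if g.2.1 = 0 then 1 else (g.2.2 : ℂ) + 1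

def dg (g : Gen A) : Gen A := (g.1, g.2.1 + 1, if g.2.1 = 0 then g.2.2 else g.2.2 + 1)

lemma gpar_dg (g : Gen A) : gpar p (dg g) = gpar p g + 1 := by
  simp only [gpar, dg, add_assoc]

lemma Par_dg : Par (π := gpar p) 1 (fun g => dc g • X (gpar p) (dg g)) := by
  intro g h
  beta_reduce
  rw [smul_mul_assoc, X_swap, gpar_dg, mul_smul_comm, smul_comm, add_comm]

/-- The odd endomorphism `D`: the odd derivation with `D (∂^k s / k!) = ∂^k D s / k!` and
`D (∂^k D s / k!) = (k + 1) ∂^(k + 1) s / (k + 1)!`. -/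
def DD : Module.End ℂ (Fock p) := sder 1 (fun g => dc g • X (gpar p) (dg g)) (Par_dg p)

lemma DD_one : DD p 1 = 0 := sder_one _

lemma DD_mul (g : Gen A) (v : Fock p) : DD p (X _ g * v)
    = dc g • (X _ (dg g) * v) + sg (gpar p g) • (X _ g * DD p v) := by
  rw [DD, sder_mul, one_mul, smul_mul_assoc]

lemma DD_X (g : Gen A) : DD p (X _ g) = dc g • X _ (dg g) := by
  have := DD_mul p g 1
  rw [mul_one, mul_one, DD_one, mul_zero, smul_zero, add_zero] at this
  exact this

lemma DD_par (v : Fock p) : par _ (DD p (par _ v)) = sg 1 • DD p v := by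
  induction v using SAlg.ind with
  | one => simp [DD_one]
  | mul g v ih =>
    have hg := sg_mul_self (gpar p g)
    rw [map_mul, par_X, smul_mul_assoc, map_smul, DD_mul, DD_mul]
    simp only [map_add, map_smul, map_mul, par_X, par_par, ih, smul_add, smul_smul,
      smul_mul_assoc, mul_smul_comm, gpar_dg]
    congr 1
    · congr 1
      rw [sg_add]
      linear_combination (dc g * sg 1) * hg
    · congr 1
      linear_combination (sg (gpar p g) * sg 1) * hg
  | add u v hu hv => simp only [map_add, smul_add, hu, hv]
  | smul c v h => simp only [map_smul, h]; rw [smul_comm]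

lemma DD_cj (e : ZMod 2) : cj (PP (gpar p)) e (DD p) = sg e • DD p := by
  have := cj_of_par p (DD_par p) e
  rwa [mul_one] at this

open Classical in
lemma DD_pd (h : Gen A) (f : Gen A → ℂ)
    (hf : ∀ g, f g = -(sg (gpar p h)) * dc g * (if dg g = h then (1 : ℂ) else 0)) :
    ∀ g v, (DD p * pd p h - sg (gpar p h) • (pd p h * DD p)) (X _ g * v)
      = (f g • (1 : Fock p)) * v + sg ((gpar p h + 1) * gpar p g) •
        (X _ g * (DD p * pd p h - sg (gpar p h) • (pd p h * DD p)) v) := by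
  intro g v
  simp only [LinearMap.sub_apply, LinearMap.smul_apply, Module.End.mul_apply]
  rw [pd_mul, DD_mul]
  simp only [map_add, map_smul]
  rw [DD_mul, pd_mul, pd_mul, gpar_dg, hf, smul_mul_assoc, one_mul]
  simp only [smul_add, smul_sub, mul_sub, smul_smul, mul_smul_comm]
  have hg := sg_mul_self (gpar p g)
  have hh := sg_mul_self (gpar p h)
  have e1 : sg (gpar p h * gpar p g) * dc g
      = sg (gpar p h) * (dc g * sg (gpar p h * (gpar p g + 1))) := by
    rw [mul_add, mul_one, sg_add]
    linear_combination (-(dc g * sg (gpar p h * gpar p g))) * hh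
  have e2 : (if g = h then (1 : ℂ) else 0) = sg (gpar p h) * (sg (gpar p g) * (if g = h then (1 : ℂ) else 0)) := by
    by_cases hgh : g = h
    · rw [← hgh, ← mul_assoc, hg, one_mul]
    · simp [hgh]
  have e3 : sg (gpar p h * gpar p g) * sg (gpar p g) = sg ((gpar p h + 1) * gpar p g) := by
    rw [add_mul, one_mul, sg_add]
  have e4 : sg (gpar p h) * (sg (gpar p g) * sg (gpar p h * gpar p g))
      = sg ((gpar p h + 1) * gpar p g) * sg (gpar p h) := by
    rw [← e3]; ring
  rw [e1, ← e2, e3, e4]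
  rw [show -sg (gpar p h) * dc g * (if dg g = h then (1 : ℂ) else 0)
    = -(sg (gpar p h) * (dc g * (if dg g = h then (1 : ℂ) else 0))) by ring]
  exact alg_aux _ _ _ _ _ _

lemma DD_pd_one (h : Gen A) : (DD p * pd p h - sg (gpar p h) • (pd p h * DD p)) 1 = 0 := by
  simp [pd_one, DD_one]

lemma dg_one (s : Base A) (n : ℕ) (g : Gen A) : dg g = (s, 1, n) ↔ g = (s, 0, n) := by
  obtain ⟨s', d, k⟩ := g
  rcases zmod2_cases d with rfl | rfl
  · simp [dg]
  · simp [dg, show (1 : ZMod 2) + 1 = 0 from rfl]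

lemma dg_zero (s : Base A) (n : ℕ) (g : Gen A) : dg g = (s, 0, n + 1) ↔ g = (s, 1, n) := by
  obtain ⟨s', d, k⟩ := g
  rcases zmod2_cases d with rfl | rfl
  · simp [dg]
  · simp [dg, show (1 : ZMod 2) + 1 = 0 from rfl]

lemma dg_zero' (s : Base A) (g : Gen A) : ¬ dg g = (s, 0, 0) := by
  obtain ⟨s', d, k⟩ := g
  rcases zmod2_cases d with rfl | rfl
  · simp [dg]
  · simp [dg, show (1 : ZMod 2) + 1 = 0 from rfl]

lemma DD_pd_o (s : Base A) (n : ℕ) :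
    DD p * pd p (s, 1, n) - sg (bpar p s + 1) • (pd p (s, 1, n) * DD p)
      = -sg (bpar p s + 1) • pd p (s, 0, n) := by
  classical
  have hp : gpar p (s, 1, n) = bpar p s + 1 := rfl
  have hp0 : gpar p (s, 0, n) = bpar p s := add_zero _
  have := DD_pd p (s, 1, n) _ (fun g => rfl)
  rw [hp] at this
  have h1 := DD_pd_one p (s, 1, n)
  rw [hp] at h1
  refine op_ext (e := bpar p s + 1 + 1) ?_ this ?_
  · rw [h1]; simp [pd_one]
  · intro g v
    rw [LinearMap.smul_apply, LinearMap.smul_apply, pd_mul, smul_mul_assoc, one_mul, smul_add,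
      smul_smul, hp0]
    congr 1
    · congr 1
      by_cases hg : g = (s, 0, n)
      · rw [if_pos hg, if_pos ((dg_one s n g).mpr hg), hg]; simp [dc]
      · rw [if_neg hg, if_neg (fun h => hg ((dg_one s n g).mp h))]; simp
    · rw [add_assoc, show (1 : ZMod 2) + 1 = 0 from rfl, add_zero, mul_smul_comm, smul_comm]

lemma DD_pd_e (s : Base A) (n : ℕ) :
    DD p * pd p (s, 0, n) - sg (bpar p s) • (pd p (s, 0, n) * DD p)
      = (-sg (bpar p s) * n) • pd p (s, 1, n - 1) := by
  classical
  have hp (n) : gpar p (s, 1, n) = bpar p s + 1 := rfl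
  have hp0 : gpar p (s, 0, n) = bpar p s := add_zero _
  have := DD_pd p (s, 0, n) _ (fun g => rfl)
  rw [hp0] at this
  have h1 := DD_pd_one p (s, 0, n)
  rw [hp0] at h1
  refine op_ext (e := bpar p s + 1) ?_ this ?_
  · rw [h1]; simp [pd_one]
  · intro g v
    rw [LinearMap.smul_apply, LinearMap.smul_apply, pd_mul, smul_mul_assoc, one_mul, smul_add,
      smul_smul, hp]
    congr 1
    · congr 1
      rcases n with _ | n
      · rw [if_neg (dg_zero' s g)]; simp
      · rw [Nat.add_sub_cancel]
        by_cases hg : g = (s, 1, n)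
        · rw [if_pos hg, if_pos ((dg_zero s n g).mpr hg), hg]; simp [dc]
        · rw [if_neg hg, if_neg (fun h => hg ((dg_zero s n g).mp h))]; simp
    · rw [mul_smul_comm, smul_comm]

lemma DD_xm_zero (s : Base A) (n : ℤ) :
    DD p * xm p s 0 n - sg (bpar p s) • (xm p s 0 n * DD p) = xm p s 1 n := by
  rcases n with n | n
  · have h := DD_pd_o p s.swap n
    rw [bpar_swap, add_assoc, show (1 : ZMod 2) + 1 = 0 from rfl, add_zero] at h
    change DD p * (sg ((0 + 1) * (bpar p s + 1)) • pd p (s.swap, 0 + 1, n))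
      - sg _ • ((sg ((0 + 1) * (bpar p s + 1)) • pd p (s.swap, 0 + 1, n)) * DD p)
      = sg ((1 + 1) * (bpar p s + 1)) • pd p (s.swap, 1 + 1, n)
    rw [zero_add, one_mul, show (1 : ZMod 2) + 1 = 0 from rfl, zero_mul, sg_zero, one_smul,
      mul_smul_comm, smul_mul_assoc]
    refine (smul_sub_smul (V := Module.End ℂ (Fock p)) _ _ _ _).trans ?_
    rw [h, smul_smul, sg_add]
    rw [sg_one, show sg (bpar p s) * -1 * -sg (bpar p s) = sg (bpar p s) * sg (bpar p s) by ring,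
      sg_mul_self, one_smul]
  · ext v
    have hp : gpar p (s, 0, n) = bpar p s := add_zero _
    change DD p (X _ (s, 0, n) * v) - sg _ • (X _ (s, 0, n) * DD p v) = X _ (s, 1, n) * v
    rw [DD_mul, hp, add_sub_cancel_right]
    simp [dc, dg]

lemma DD_xm_one (s : Base A) (n : ℤ) :
    DD p * xm p s 1 n - sg (bpar p s + 1) • (xm p s 1 n * DD p)
      = (-(n : ℂ)) • xm p s 0 (n - 1) := by
  have two : (1 : ZMod 2) + 1 = 0 := rfl
  rcases n with n | n
  · have h := DD_pd_e p s.swap n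
    rw [bpar_swap] at h
    change DD p * (sg ((1 + 1) * (bpar p s + 1)) • pd p (s.swap, 1 + 1, n))
      - sg _ • ((sg ((1 + 1) * (bpar p s + 1)) • pd p (s.swap, 1 + 1, n)) * DD p) = _
    rw [two, zero_mul, sg_zero, one_smul, h]
    rcases n with _ | n
    · simp
    · have : Int.ofNat (n + 1) - 1 = Int.ofNat n := by simp
      rw [this]
      change _ = _ • (sg ((0 + 1) * (bpar p s + 1)) • pd p (s.swap, 0 + 1, n))
      rw [zero_add, one_mul, smul_smul]
      congr 1
      simp
      ring
  · ext v
    have hp : gpar p (s, 1, n) = bpar p s + 1 := rfl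
    have : Int.negSucc n - 1 = Int.negSucc (n + 1) := by
      rw [Int.negSucc_eq, Int.negSucc_eq]; push_cast; ring
    rw [this]
    change DD p (X _ (s, 1, n) * v) - sg _ • (X _ (s, 1, n) * DD p v)
      = (-((Int.negSucc n : ℤ) : ℂ)) • (X (gpar p) (s, 0, n + 1) * v)
    rw [DD_mul, hp, add_sub_cancel_right]
    simp only [dc, dg, two, one_ne_zero, if_false]
    congr 1
    rw [Int.negSucc_eq]
    push_cast
    ring

lemma adD_fld (g : Gen A) : adD (PP (gpar p)) (DD p) (fld p g) = dc g • fld p (dg g) := by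
  have two : (1 : ZMod 2) + 1 = 0 := rfl
  apply Subtype.ext
  funext n
  change DD p * (fld p g).1 n - cj _ 1 ((fld p g).1 n) * DD p
    = dc g • (cb (dg g).2.2 n • xm p g.1 (g.2.1 + 1) (n - (dg g).2.2))
  rw [fld_hom, one_mul, smul_mul_assoc]
  change DD p * (cb g.2.2 n • xm p g.1 g.2.1 (n - g.2.2))
    - _ • ((cb g.2.2 n • xm p g.1 g.2.1 (n - g.2.2)) * DD p) = _
  rw [mul_smul_comm, smul_mul_assoc]
  refine (smul_sub_smul (V := Module.End ℂ (Fock p)) _ _ _ _).trans ?_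
  obtain ⟨s, d, k⟩ := g
  rcases zmod2_cases d with rfl | rfl
  · have hp : gpar p (s, 0, k) = bpar p s := add_zero _
    rw [hp, DD_xm_zero]
    simp [dc, dg]
  · have hp : gpar p (s, 1, k) = bpar p s + 1 := rfl
    rw [hp, DD_xm_one]
    simp only [dc, dg, two, one_ne_zero, if_false]
    rw [smul_smul, smul_smul, succ_cb]
    congr 1
    · push_cast; ring
    · congr 1
      push_cast; ring

lemma dz_fld (s : Base A) (d : ZMod 2) (k : ℕ) :
    dz (fld p (s, d, k)) = ((k : ℂ) + 1) • fld p (s, d, k + 1) := by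
  apply Subtype.ext
  funext n
  change (-(n : ℂ)) • (cb k (n - 1) • xm p s d (n - 1 - k))
    = ((k : ℂ) + 1) • (cb (k + 1) n • xm p s d (n - ((k + 1 : ℕ) : ℤ)))
  rw [smul_smul, smul_smul, succ_cb']
  congr 2
  push_cast; ring

lemma YY_DD (v : Fock p) : YY p (DD p v) = adD (PP (gpar p)) (DD p) (YY p v) := by
  induction v using SAlg.ind with
  | one =>
    rw [DD_one, map_zero, YY_one]
    apply Subtype.ext
    funext n
    change 0 = DD p * (if n = -1 then 1 else 0) - cj _ 1 (if n = -1 then 1 else 0) * DD p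
    split_ifs
    · have : cj (PP (gpar p)) 1 1 = 1 := by simp [cj, tw, PP_sq]
      rw [this, mul_one, one_mul]
      exact (sub_self_aux (V := Module.End ℂ (Fock p)) _).symm
    · have : cj (PP (gpar p)) 1 0 = 0 := by simp [cj]
      rw [this, mul_zero, zero_mul]
      exact (zero_sub_zero_aux (V := Module.End ℂ (Fock p))).symm
  | mul g v ih =>
    rw [DD_mul, map_add, map_smul, map_smul, YY_mul, YY_mul, YY_mul, ih,
      adD_nop PP_sq (DD_cj p) _ (fld_hom p g), adD_fld, nop_smul_left, gpar_dg]
  | add u v hu hv => rw [map_add, map_add, map_add, adD_add, hu, hv]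
  | smul c v h => rw [map_smul, map_smul, map_smul, adD_smul, h]

lemma DD_DD_mul (s : Base A) (d : ZMod 2) (k : ℕ) (v : Fock p) :
    DD p (DD p (X _ (s, d, k) * v))
      = ((k : ℂ) + 1) • (X _ (s, d, k + 1) * v) + X _ (s, d, k) * DD p (DD p v) := by
  rw [DD_mul, map_add, map_smul, map_smul, DD_mul, DD_mul, gpar_dg]
  have h1 : dg (dg (s, d, k)) = (s, d, k + 1) := by
    rcases zmod2_cases d with rfl | rfl <;> simp [dg, show (1 : ZMod 2) + 1 = 0 from rfl]
  have h2 : dc (s, d, k) * dc (dg (s, d, k)) = (k : ℂ) + 1 := by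
    rcases zmod2_cases d with rfl | rfl <;> simp [dg, dc, show (1 : ZMod 2) + 1 = 0 from rfl]
  rw [h1]
  simp only [smul_add, smul_smul]
  rw [h2, sg_mul_self, one_smul, sg_add, sg_one,
    show dc (s, d, k) * (sg (gpar p (s, d, k)) * -1) = -(sg (gpar p (s, d, k)) * dc (s, d, k)) by
      ring, neg_smul]
  abel

lemma YY_der (v : Fock p) : YY p (DD p (DD p v)) = dz (YY p v) := by
  induction v using SAlg.ind with
  | one =>
    rw [DD_one, map_zero, map_zero, YY_one]
    apply Subtype.ext
    funext n
    change 0 = (-(n : ℂ)) • (if n - 1 = -1 then (1 : Module.End ℂ (Fock p)) else 0)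
    split_ifs with h
    · rw [show n = 0 by omega]; simp
    · simp
  | mul g v ih =>
    obtain ⟨s, d, k⟩ := g
    rw [DD_DD_mul, map_add, map_smul, YY_mul, YY_mul, YY_mul, ih, dz_nop, dz_fld, nop_smul_left]
    rfl
  | add u v hu hv => rw [map_add, map_add, map_add, map_add, dz_add, hu, hv]
  | smul c v h => rw [map_smul, map_smul, map_smul, map_smul, dz_smul, h]

/-! Parity -/

lemma YY_cj (d : ZMod 2) (v : Fock p) : cjF (PP (gpar p)) d (YY p v) = YY p (tw (PP _) d v) := by
  rcases zmod2_cases d with rfl | rfl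
  · apply Subtype.ext
    funext n
    simp [cjF, cj, tw]
  change _ = YY p (par _ v)
  induction v using SAlg.ind with
  | one =>
    rw [map_one (par (gpar p)), YY_one]
    apply Subtype.ext
    funext n
    change cj _ 1 (if n = -1 then 1 else 0) = (if n = -1 then 1 else 0)
    split_ifs
    · simp [cj, tw, PP_sq]
    · simp [cj]
  | mul g v ih =>
    rw [YY_mul, cjF_nop PP_sq 1 _ _ (fld_hom p g), ih, map_mul, par_X, smul_mul_assoc, map_smul,
      YY_mul, one_mul]
  | add u v hu hv =>
    rw [map_add, map_add, map_add, ← hu, ← hv]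
    apply Subtype.ext
    funext n
    exact cj_add _ _ _ _
  | smul c v h =>
    rw [map_smul, map_smul, map_smul, ← h]
    apply Subtype.ext
    funext n
    exact cj_smul _ _ _ _

lemma tw_of_mem {i : ZMod 2} {v : Fock p} (h : v ∈ gr (gpar p) i) (e : ZMod 2) :
    tw (PP (gpar p)) e v = sg (e * i) • v := by
  rcases zmod2_cases e with rfl | rfl
  · simp [tw]
  · rw [one_mul]; exact h

lemma YY_hom {i : ZMod 2} {v : Fock p} (h : v ∈ gr (gpar p) i) : Hom (PP (gpar p)) i (YY p v) := by
  intro e n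
  have h1 := YY_cj p e v
  rw [tw_of_mem p h, map_smul] at h1
  exact congrFun (congrArg Subtype.val h1) n

lemma YY_mem {i j : ZMod 2} {v w : Fock p} (hv : v ∈ gr (gpar p) i) (hw : w ∈ gr (gpar p) j)
    (n : ℤ) : (YY p v).1 n w ∈ gr (gpar p) (i + j) := by
  have h := congrArg (fun S => S (tw (PP (gpar p)) 1 w)) (YY_hom p hv 1 n)
  simp only [cj_apply, LinearMap.smul_apply] at h
  rw [← Module.End.mul_apply (tw (PP (gpar p)) 1) (tw (PP (gpar p)) 1), tw_mul_self PP_sq,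
    Module.End.one_apply, tw_of_mem p hw, map_smul, smul_smul, one_mul, one_mul] at h
  rw [mem_gr, sg_add]
  exact h

lemma DD_mem {i : ZMod 2} {v : Fock p} (h : v ∈ gr (gpar p) i) : DD p v ∈ gr (gpar p) (i + 1) := by
  have h1 := DD_par p v
  rw [mem_gr.mp h, map_smul, map_smul] at h1
  rw [mem_gr, sg_add, mul_smul, ← h1, smul_smul, sg_mul_self, one_smul]

/-! Vacuum -/

lemma fld_vac (g : Gen A) (n : ℤ) (hn : 0 ≤ n) : (fld p g).1 n 1 = 0 := by
  obtain ⟨c, h, -, e⟩ := fld_nonneg p g n hn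
  rw [e, LinearMap.smul_apply, pd_one, smul_zero]

lemma fld_neg_one (g : Gen A) (v : Fock p) : (fld p g).1 (-1) v = X _ g * v := by
  change (cb g.2.2 (-1) • xm p g.1 g.2.1 (-1 - g.2.2)) v = _
  rw [cb_neg_one, one_smul, xm_neg]

lemma YY_vac_nonneg (v : Fock p) : ∀ n, 0 ≤ n → (YY p v).1 n 1 = 0 := by
  induction v using SAlg.ind with
  | one =>
    intro n hn
    rw [YY_one]
    change (if n = -1 then (1 : Module.End ℂ (Fock p)) else 0) 1 = 0
    rw [if_neg (by omega)]; rfl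
  | mul g v ih =>
    intro n hn
    rw [YY_mul, nop_vac _ _ (fld_vac p g)]
    have : ∀ j : ℕ, (fld p g).1 (-1 - j) ((YY p v).1 (n + j) 1) = 0 := fun j => by
      rw [ih _ (by omega), map_zero]
    simp [this]
  | add u v hu hv => intro n hn; simp [hu n hn, hv n hn]
  | smul c v h => intro n hn; simp [h n hn]

lemma YY_vac (v : Fock p) : (YY p v).1 (-1) 1 = v := by
  induction v using SAlg.ind with
  | one => rw [YY_one]; rfl
  | mul g v ih =>
    rw [YY_mul, nop_vac _ _ (fld_vac p g), fs_succ (nop_ez1 _ _ _ _)]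
    have : ∀ j : ℕ, (fld p g).1 (-1 - ((j + 1 : ℕ) : ℤ))
        ((YY p v).1 (-1 + ((j + 1 : ℕ) : ℤ)) 1) = 0 := fun j => by
      rw [YY_vac_nonneg p v _ (by push_cast; omega), map_zero]
    simp only [this, finsum_zero, add_zero]
    simp only [Nat.cast_zero, sub_zero, add_zero]
    rw [fld_neg_one, ih]
  | add u v hu hv => simp [hu, hv]
  | smul c v h => simp [h]

/-! Locality -/

/-- Twice the projection to parity `i`. -/
def pr (i : ZMod 2) : Module.End ℂ (Fock p) := 1 + sg i • PP (gpar p)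

lemma pr_mul (i : ZMod 2) (g : Gen A) (v : Fock p) :
    pr p i (X _ g * v) = X _ g * pr p (i + gpar p g) v := by
  simp only [pr, LinearMap.add_apply, LinearMap.smul_apply, Module.End.one_apply, PP_apply, map_mul,
    par_X, mul_add, smul_mul_assoc, mul_smul_comm, smul_smul, sg_add]

lemma pr_mem (i : ZMod 2) (v : Fock p) : pr p i v ∈ gr (gpar p) i := by
  rw [mem_gr]
  simp only [pr, LinearMap.add_apply, LinearMap.smul_apply, Module.End.one_apply, PP_apply, map_add,
    map_smul, par_par, smul_add, smul_smul, sg_mul_self, one_smul]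
  rw [add_comm]

lemma pr_of_mem {i : ZMod 2} {v : Fock p} (h : v ∈ gr (gpar p) i) : pr p i v = (2 : ℂ) • v := by
  simp only [pr, LinearMap.add_apply, LinearMap.smul_apply, Module.End.one_apply, PP_apply]
  rw [mem_gr.mp h, smul_smul, sg_mul_self, one_smul, two_smul]

lemma pr_one (i : ZMod 2) : pr p i 1 = (1 + sg i) • (1 : Fock p) := by
  simp [pr, PP_apply, add_smul]

lemma loc_one (i j : ZMod 2) (a : ℤ → Module.End ℂ (Fock p)) :
    LocN 0 (sg (i * j)) a (YY p (pr p j 1)).1 := by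
  intro m n
  rw [pr_one, map_smul, YY_one]
  simp only [zero_add, Finset.sum_range_one, pow_zero, Nat.choose_self, Nat.cast_one, mul_one,
    one_smul]
  change a _ * ((1 + sg j) • (if _ then 1 else 0)) - _ • (((1 + sg j) • (if _ then 1 else 0)) * a _)
    = 0
  rcases zmod2_cases j with rfl | rfl
  · split_ifs
    · simp only [mul_zero, sg_zero, one_smul, mul_smul_comm, smul_mul_assoc, mul_one,
        one_mul]
      exact sub_self_aux (V := Module.End ℂ (Fock p)) _
    · simp only [mul_zero, zero_mul, smul_zero]
      exact zero_sub_zero_aux (V := Module.End ℂ (Fock p))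
  · simp only [sg_one, add_neg_cancel, zero_smul, mul_zero, zero_mul, smul_zero]
    exact zero_sub_zero_aux (V := Module.End ℂ (Fock p))

lemma loc1 (u : Fock p) : ∀ (g : Gen A) (j : ZMod 2),
    ∃ N, LocN N (sg (gpar p g * j)) (fld p g).1 (YY p (pr p j u)).1 := by
  induction u using SAlg.ind with
  | one => exact fun g j => ⟨0, loc_one p _ j _⟩
  | mul h u ih =>
    intro g j
    rw [pr_mul, YY_mul]
    obtain ⟨N1, h1⟩ := fld_loc p h g
    obtain ⟨N2, h2⟩ := ih g (j + gpar p h)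
    obtain ⟨N3, h3⟩ := ih h (j + gpar p h)
    have h4 := dong (P := PP (gpar p)) (e := gpar p h) (N := max N1 (max N2 N3))
      (YY_hom p (pr_mem p (j + gpar p h) u))
      (h1.mono (le_max_left _ _))
      ((h2.symm (sg_mul_self _)).mono (le_trans (le_max_left _ _) (le_max_right _ _)))
      (h3.mono (le_trans (le_max_right _ _) (le_max_right _ _)))
    have e : sg (gpar p h * gpar p g) * sg (gpar p g * (j + gpar p h)) = sg (gpar p g * j) := by
      rw [mul_add, sg_add, mul_comm (gpar p h)]
      linear_combination sg (gpar p g * j) * sg_mul_self (gpar p g * gpar p h)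
    rw [e] at h4
    exact ⟨_, h4.symm (sg_mul_self _)⟩
  | add u v hu hv =>
    intro g j
    obtain ⟨N, hN⟩ := hu g j
    obtain ⟨M, hM⟩ := hv g j
    refine ⟨max N M, ?_⟩
    rw [map_add, map_add]
    exact (hN.mono (le_max_left _ _)).add (hM.mono (le_max_right _ _))
  | smul c v h =>
    intro g j
    obtain ⟨N, hN⟩ := h g j
    refine ⟨N, ?_⟩
    rw [map_smul, map_smul]
    exact hN.smul c

lemma loc2 (v : Fock p) : ∀ (i j : ZMod 2) (u : Fock p),
    ∃ N, LocN N (sg (i * j)) (YY p (pr p i v)).1 (YY p (pr p j u)).1 := by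
  induction v using SAlg.ind with
  | one =>
    intro i j u
    have h := loc_one p j i (YY p (pr p j u)).1
    rw [mul_comm] at h
    exact ⟨0, h.symm (sg_mul_self _)⟩
  | mul g v ih =>
    intro i j u
    rw [pr_mul, YY_mul]
    obtain ⟨N1, h1⟩ := loc1 p u g j
    obtain ⟨N2, h2⟩ := ih (i + gpar p g) j u
    obtain ⟨N3, h3⟩ := loc1 p v g (i + gpar p g)
    have h4 := dong (P := PP (gpar p)) (e := gpar p g) (N := max N1 (max N2 N3))
      (YY_hom p (pr_mem p (i + gpar p g) v))
      (h1.mono (le_max_left _ _))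
      (h2.mono (le_trans (le_max_left _ _) (le_max_right _ _)))
      (h3.mono (le_trans (le_max_right _ _) (le_max_right _ _)))
    have e : sg (gpar p g * j) * sg ((i + gpar p g) * j) = sg (i * j) := by
      rw [add_mul, sg_add]
      linear_combination sg (i * j) * sg_mul_self (gpar p g * j)
    rw [e] at h4
    exact ⟨_, h4⟩
  | add v w hv hw =>
    intro i j u
    obtain ⟨N, hN⟩ := hv i j u
    obtain ⟨M, hM⟩ := hw i j u
    refine ⟨max N M, ?_⟩
    rw [map_add, map_add]
    have hs := sg_mul_self (i * j)
    exact (((hN.symm hs).mono (le_max_left _ _)).add ((hM.symm hs).mono (le_max_right _ _))).symm hs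
  | smul c v h =>
    intro i j u
    obtain ⟨N, hN⟩ := h i j u
    refine ⟨N, ?_⟩
    rw [map_smul, map_smul]
    have hs := sg_mul_self (i * j)
    exact ((hN.symm hs).smul c).symm hs

lemma YY_loc {i j : ZMod 2} {v u : Fock p} (hv : v ∈ gr (gpar p) i) (hu : u ∈ gr (gpar p) j) :
    ∃ N, LocN N (sg (i * j)) (YY p v).1 (YY p u).1 := by
  obtain ⟨N, hN⟩ := loc2 p ((1 / 2 : ℂ) • v) i j ((1 / 2 : ℂ) • u)
  rw [map_smul (pr p i), map_smul (pr p j), pr_of_mem p hv, pr_of_mem p hu, smul_smul,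
    smul_smul, show (1 / 2 : ℂ) * 2 = 1 by norm_num, one_smul, one_smul] at hN
  exact ⟨N, hN⟩

/-- The modes `v_(n|1)`, given by `Y(v)_n`, and `v_(n|0)`, given by `Y(D v)_n`. -/
def smode (n : ℤ) (i : ZMod 2) : Fock p →ₗ[ℂ] Module.End ℂ (Fock p) where
  toFun v := (YY p (if i = 1 then v else DD p v)).1 n
  map_add' u v := by split_ifs <;> simp
  map_smul' c v := by split_ifs <;> simp

lemma smode_one (n : ℤ) (v : Fock p) : smode p n 1 v = (YY p v).1 n := by
  change (YY p (if (1 : ZMod 2) = 1 then v else DD p v)).1 n = _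
  rw [if_pos rfl]

lemma smode_zero (n : ℤ) (v : Fock p) : smode p n 0 v = (YY p (DD p v)).1 n := by
  change (YY p (if (0 : ZMod 2) = 1 then v else DD p v)).1 n = _
  rw [if_neg zero_ne_one]

lemma smode_eq (i : ZMod 2) {q : ZMod 2} {v : Fock p} (hv : v ∈ gr (gpar p) q) :
    ∃ v' ∈ gr (gpar p) (q + (i + 1)), ∀ n, smode p n i v = (YY p v').1 n := by
  rcases zmod2_cases i with rfl | rfl
  · exact ⟨DD p v, by rw [zero_add]; exact DD_mem p hv, fun n => smode_zero p n v⟩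
  · exact ⟨v, by rw [show (1 : ZMod 2) + 1 = 0 from rfl, add_zero]; exact hv,
      fun n => smode_one p n v⟩

lemma scomm_DD {q : ZMod 2} {v : Fock p} (hv : v ∈ gr (gpar p) q) (n : ℤ) :
    scomm 1 q (DD p) ((YY p v).1 n) = (YY p (DD p v)).1 n := by
  rw [YY_DD]
  change _ = DD p * (YY p v).1 n - cj _ 1 ((YY p v).1 n) * DD p
  rw [YY_hom p hv, scomm, smul_mul_assoc]

/-- The SUSY charged free fermion vertex algebra `F^ch`: the `N_K = 1` SUSY vertex algebra freely
generated by the `φ_a` and `φ^ā`, with nonzero `Λ`-brackets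
`[φ_a _Λ φ^ā] = [φ^ā _Λ φ_a] = 1` of the generators. -/
def Fch : SUSYVertexAlgebra (Fock p) where
  gr := gr (gpar p)
  gr_isInternal := gr_internal
  vac := 1
  vac_mem := by rw [mem_gr]; simp
  D := DD p
  D_mem i v h := DD_mem p h
  mode := smode p
  mode_mem := by
    intro n i q r a b ha hb
    obtain ⟨a', ha', h⟩ := smode_eq p i ha
    rw [h]
    exact YY_mem p ha' hb n
  mode_field := by
    intro a b
    obtain ⟨N, hN⟩ := (YY p a).2 b
    obtain ⟨M, hM⟩ := (YY p (DD p a)).2 b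
    refine ⟨max N M, fun n hn i => ?_⟩
    rcases zmod2_cases i with rfl | rfl
    · rw [smode_zero]; exact hM n (le_trans (le_max_right _ _) hn)
    · rw [smode_one]; exact hN n (le_trans (le_max_left _ _) hn)
  D_vac := DD_one p
  mode_vac_nonneg := by
    intro a n hn i
    rcases zmod2_cases i with rfl | rfl
    · rw [smode_zero]; exact YY_vac_nonneg p _ n hn
    · rw [smode_one]; exact YY_vac_nonneg p _ n hn
  mode_vac a := by rw [smode_one]; exact YY_vac p a
  translation_one := by
    intro q a ha n
    rw [smode_one, smode_zero]
    exact scomm_DD p ha n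
  translation_zero := by
    intro q a ha n
    rw [smode_one, smode_zero, scomm_DD p (DD_mem p ha), YY_der]
    rfl
  locality := by
    intro q r a b ha hb
    have h1 : ∀ i j : ZMod 2, ∃ N, LocN N (sg ((q + (i + 1)) * (r + (j + 1))))
        (fun n => smode p n i a) (fun n => smode p n j b) := by
      intro i j
      obtain ⟨a', ha', h⟩ := smode_eq p i ha
      obtain ⟨b', hb', h'⟩ := smode_eq p j hb
      simp only [h, h']
      exact YY_loc p ha' hb'
    choose N hN using h1
    refine ⟨max (max (N 0 0) (N 0 1)) (max (N 1 0) (N 1 1)), fun i j m n => ?_⟩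
    have hle : N i j ≤ max (max (N 0 0) (N 0 1)) (max (N 1 0) (N 1 1)) := by
      rcases zmod2_cases i with rfl | rfl <;> rcases zmod2_cases j with rfl | rfl <;> simp
    exact ((hN i j).mono hle) m n

/-! The brackets and the products of the generators -/

lemma nop_idF (e : ZMod 2) (a : Fld (Fock p)) : nop (PP (gpar p)) e a (idF p) = a := by
  ext n w
  change (nop _ e a (idF p)).1 n w = a.1 n w
  have hid : ∀ (m : ℤ), cj (PP (gpar p)) e ((idF p).1 m) = (idF p).1 m := by
    intro m
    change cj _ e (if m = -1 then 1 else 0) = if m = -1 then 1 else 0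
    split_ifs
    · rw [cj, mul_one, tw_mul_self PP_sq]
    · simp [cj]
  have hap : ∀ (m : ℤ) (u : Fock p), (idF p).1 m u = if m = -1 then u else 0 := by
    intro m u
    change (if m = -1 then (1 : Module.End ℂ (Fock p)) else 0) u = _
    split_ifs <;> rfl
  rw [nop_apply]
  simp only [hid, hap]
  rcases lt_or_ge n 0 with hn | hn
  · rw [finsum_eq_single _ (-1 - n).toNat, finsum_eq_zero_of_forall_eq_zero, add_zero]
    · have h := Int.toNat_of_nonneg (show 0 ≤ -1 - n by omega)
      rw [h, if_pos (by ring), show -1 - (-1 - n) = n by ring]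
    · intro j
      rw [if_neg (by omega)]
    · intro j hj
      rw [if_neg (by omega), map_zero]
  · rw [finsum_eq_zero_of_forall_eq_zero, finsum_eq_single _ n.toNat, zero_add]
    · have h := Int.toNat_of_nonneg hn
      rw [h, if_pos (by ring)]
    · intro j hj
      rw [if_neg (by omega)]
    · intro j
      rw [if_neg (by omega), map_zero]

lemma YY_X (g : Gen A) : YY p (X _ g) = fld p g := by
  have h := YY_mul p g 1
  rwa [mul_one, YY_one, nop_idF] at h

/-- The normally ordered product `:g v:` with a generator `g` is the product in the free
supercommutative algebra. -/
theorem Fch_nprod (g : Gen A) (v : Fock p) : (Fch p).nprod (X _ g) v = X _ g * v := by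
  change smode p (-1) 1 (X _ g) v = _
  rw [smode_one, YY_X, fld_neg_one]

/-- The element of `Fock p` given by `φ_a` (`s = Sum.inl a`) or `φ^ā` (`s = Sum.inr a`). -/
def gen (s : Base A) : Fock p := X _ (s, 0, 0)

/-- The generator `φ_a`. -/
def phi (a : A) : Fock p := gen p (Sum.inl a)

/-- The generator `φ^ā`. -/
def phibar (a : A) : Fock p := gen p (Sum.inr a)

open Classical in
/-- The `Λ`-brackets of the generators: `[φ_a _Λ φ^b̄] = [φ^b̄ _Λ φ_a] = δ_{ab}`, the others vanish. -/
theorem Fch_bracket (s s' : Base A) : (Fch p).bracket (gen p s) (gen p s')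
    = Finsupp.single (0, 0) (if s' = s.swap then (Fch p).vac else 0) := by
  ext ⟨j, i⟩
  change ((j.factorial : ℂ)⁻¹) • smode p j i (gen p s) (gen p s') = _
  have two : (1 : ZMod 2) + 1 = 0 := rfl
  rcases zmod2_cases i with rfl | rfl
  · have hD : DD p (gen p s) = X _ (s, 1, 0) := by
      rw [gen, DD_X]; simp [dc, dg]
    rw [smode_zero, hD, YY_X]
    change _ • (cb 0 j • xm p s 1 (j - ((0 : ℕ) : ℤ))) (X _ (s', 0, 0)) = _
    rw [cb_zero, one_smul, Nat.cast_zero, sub_zero, xm_nonneg, two, zero_mul, sg_zero, one_smul]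
    have h := pd_mul p (s.swap, 0, j) (s', 0, 0) 1
    rw [mul_one, pd_one, mul_zero, smul_zero, add_zero] at h
    rw [h]
    rcases j with _ | j
    · by_cases hs : s' = s.swap
      · simp [hs]; rfl
      · simp [hs]
    · rw [if_neg (by simp), zero_smul, smul_zero, Finsupp.single_apply, if_neg (by simp)]
  · rw [smode_one, gen, YY_X]
    change _ • (cb 0 j • xm p s 0 (j - ((0 : ℕ) : ℤ))) (X _ (s', 0, 0)) = _
    rw [cb_zero, one_smul, Nat.cast_zero, sub_zero, xm_nonneg]
    have h := pd_mul p (s.swap, 0 + 1, j) (s', 0, 0) 1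
    rw [mul_one, pd_one, mul_zero, smul_zero, add_zero, if_neg (by simp), zero_smul] at h
    rw [h, smul_zero, smul_zero, Finsupp.single_apply, if_neg (by simp)]

/-- The shifted superconformal vector `T_sh`. -/
def Tsh [Fintype A] (t : A → ℂ) : Fock p :=
  ∑ a with p a = 0,
    ((t a + 1) • (Fch p).nprod ((Fch p).der (phi p a)) (phibar p a)
      + t a • (Fch p).nprod (phi p a) ((Fch p).der (phibar p a))
      + (Fch p).nprod ((Fch p).D (phi p a)) ((Fch p).D (phibar p a)))
  + ∑ a with p a = 1,
    (t a • (Fch p).nprod ((Fch p).der (phi p a)) (phibar p a)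
      + (t a + 1) • (Fch p).nprod (phi p a) ((Fch p).der (phibar p a))
      + (Fch p).nprod ((Fch p).D (phi p a)) ((Fch p).D (phibar p a)))

end Fermion

end

end SusyVA

/-! In `Fch` the coefficient of `χ λ^j / j!` in `[T _Λ v]` is the mode `Y(T)_j v`, and the
coefficient of `λ^j / j!` is `Y(D T)_j v`. So the statement concerns the nonnegative modes of two
vectors, `T` and `D T`, on a generator. Both are quadratic in the generators and their derivatives.

For a product `g h` of two free generators the normally ordered product acts on a third one by a
single contraction: one factor is paired with it, producing a multiple of the vacuum, and the other
factor is then created from the vacuum, possibly with some extra derivatives. This is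
`YY_X_mul_X_gen`. A factor contracts with `s` only if it is a `∂`-derivative of `D s'`, where `s'`
is the partner of `s` under `φ_a ↔ φ^ā`; factors without a `D` never contribute, because the
brackets of the generators have no `χ` term. In particular only the summand of `T` indexed by `a`
acts on `φ_a` and `φ^ā` (`YY_quad_of_ne`, `YY_Tsh_gen`).

Write that summand as `α ∂φ φ̄ + β φ ∂φ̄ + Dφ Dφ̄` and let `ε` be `(-1)^(p(a))`. In the summand only
`Dφ Dφ̄` contracts, and it gives exactly the term `χ D v`, whatever `α` and `β` are. In its image
under `D`, computed in `DD_quad`, two terms contract with each generator. They give `(1 + (α - β) ε)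
∂v` in degree zero, while the coefficient of `λ` is `-β ε φ` on `φ` and `α ε φ̄` on `φ̄`. No factor
carries more than one `∂`, so `λ^2` does not occur and both generators are primary.

The condition for the term `2∂v` is therefore `α - β = ε` (`one_add_sub_mul_sg`), which is why the
`1` accompanies `∂φ φ̄` for even `a` and `φ ∂φ̄` for odd `a`. The parameter `t_a` multiplies the
total derivative `∂(φ φ̄)`: it leaves `α - β` alone and only shifts the weights `-β ε / 2` and `α ε
/ 2`, whose sum is always `1/2`. -/

namespace SusyVA

noncomputable section

/-! ### Contractions of a product of two generators with a third generator -/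

section Wick

variable {A : Type*} (p : A → ZMod 2)

open Classical in
/-- The nonnegative modes of the field of a generator on `φ_a`, `φ^ā`. -/
lemma fld_nonneg_gen (h : Gen A) (s : Base A) (m : ℕ) :
    (fld p h).1 m (gen p s)
      = (if h.1 = s.swap ∧ h.2.1 = 1 ∧ h.2.2 = m then (-1 : ℂ) ^ m else 0) • (1 : Fock p) := by
  obtain ⟨u, d, k⟩ := h
  change cb k m • xm p u d (m - k) (gen p s) = _
  rcases lt_or_ge m k with hm | hm
  -- Here `m - k` is negative, so the underlying mode is a multiplication operator and does not
  -- vanish; it is the binomial coefficient of `m` over `k` that is zero.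
  · rw [cb_eq_zero (by omega) (by omega), zero_smul, if_neg (by simp only; omega), zero_smul]
  · have e : (m : ℤ) - k = ((m - k : ℕ) : ℤ) := by omega
    -- Reading the generator as a product with `1` reduces its derivative to the Kronecker delta,
    -- since `pd` kills `1`.
    have h1 := pd_mul p (u.swap, d + 1, m - k) (s, 0, 0) 1
    rw [mul_one, pd_one, mul_zero, smul_zero, add_zero] at h1
    rw [e, xm_nonneg, gen, h1, smul_smul, smul_smul]
    congr 1
    -- Both `swap` and `d ↦ d + 1` are involutions, so being dual to `(s, 0, 0)` can be solved for
    -- `u` and `d`. The truncated difference `m - k` is zero exactly when `k = m` because `k ≤ m` in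
    -- this branch.
    have hiff : ((s, 0, 0) : Gen A) = (u.swap, d + 1, m - k)
        ↔ u = s.swap ∧ d = 1 ∧ k = m := by
      simp only [Prod.mk.injEq]
      refine and_congr ?_ (and_congr ?_ (by omega))
      · constructor <;> rintro rfl <;> simp
      · rcases zmod2_cases d with rfl | rfl <;> simp [show (1 : ZMod 2) + 1 = 0 from rfl]
    rw [if_congr hiff rfl rfl]
    split_ifs with hc
    · obtain ⟨-, rfl, rfl⟩ := hc
      -- For `d = 1` the sign in `xm` is trivial, and the remaining `cb m m` is `(-1)^m`.
      rw [show (1 : ZMod 2) + 1 = 0 from rfl, zero_mul, sg_zero, cb, Ring.choose_natCast]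
      simp
    · simp

/-- The negative modes of the field of a generator on the vacuum. -/
lemma fld_neg_vac (g : Gen A) (j : ℕ) :
    (fld p g).1 (-1 - j) 1 = cb g.2.2 (-1 - j) • X _ (g.1, g.2.1, j + g.2.2) := by
  change cb g.2.2 (-1 - j) • xm p g.1 g.2.1 (-1 - j - g.2.2) 1 = _
  rw [show (-1 : ℤ) - j - g.2.2 = -1 - ((j + g.2.2 : ℕ) : ℤ) by push_cast; ring, xm_neg, mul_one]

open Classical in
/-- The Wick formula for a product of two generators, acting on `φ_a`, `φ^ā`. -/
lemma YY_X_mul_X_gen (g h : Gen A) (s : Base A) (n : ℕ) :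
    (YY p (X _ g * X _ h)).1 n (gen p s)
      = (if h.1 = s.swap ∧ h.2.1 = 1 ∧ n ≤ h.2.2 then
          ((-1) ^ h.2.2 * cb g.2.2 (-1 - (h.2.2 - n : ℕ))) •
            X (gpar p) (g.1, g.2.1, h.2.2 - n + g.2.2) else 0)
        + (if g.1 = s.swap ∧ g.2.1 = 1 ∧ n ≤ g.2.2 then
          (sg (gpar p g * gpar p h) * (-1) ^ g.2.2 * cb h.2.2 (-1 - (g.2.2 - n : ℕ))) •
            X (gpar p) (h.1, h.2.1, g.2.2 - n + h.2.2) else 0) := by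
  rw [YY_mul, YY_X, nop_apply]
  congr 1
  · have key : ∀ j : ℕ, (fld p g).1 (-1 - j) ((fld p h).1 (n + j) (gen p s))
        = if h.1 = s.swap ∧ h.2.1 = 1 ∧ h.2.2 = n + j then
            (-1 : ℂ) ^ h.2.2 • (fld p g).1 (-1 - j) 1 else 0 := by
      intro j
      rw [← Nat.cast_add, fld_nonneg_gen, map_smul]
      split_ifs with hc
      · rw [hc.2.2]
      · rw [zero_smul]
    simp only [key]
    -- The inner mode `n + j` must equal the number of derivatives on `h`, so at most one `j`
    -- contributes.
    rw [finsum_eq_single _ (h.2.2 - n)]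
    · by_cases hc : h.1 = s.swap ∧ h.2.1 = 1 ∧ n ≤ h.2.2
      · rw [if_pos hc, if_pos ⟨hc.1, hc.2.1, by omega⟩, fld_neg_vac, smul_smul]
      -- When `n` exceeds `h.2.2` the subtraction truncates to `j = 0`, and then `h.2.2 = n + 0`
      -- fails, so this term is zero as well.
      · rw [if_neg hc, if_neg fun h' => hc ⟨h'.1, h'.2.1, by have := h'.2.2; omega⟩]
    · intro j hj
      exact if_neg fun hc => hj (by have := hc.2.2; omega)
  · have key : ∀ j : ℕ, cj (PP (gpar p)) (gpar p g) ((fld p h).1 (n - 1 - j))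
          ((fld p g).1 j (gen p s))
        = if g.1 = s.swap ∧ g.2.1 = 1 ∧ g.2.2 = j then
            (sg (gpar p g * gpar p h) * (-1 : ℂ) ^ g.2.2) • (fld p h).1 (n - 1 - g.2.2) 1 else 0 := by
      intro j
      -- Homogeneity of the field of `h` turns conjugation by the parity involution into the sign of
      -- exchanging `g` and `h`.
      rw [fld_hom p h, fld_nonneg_gen, LinearMap.smul_apply, map_smul, smul_smul]
      split_ifs with hc
      · rw [hc.2.2]
      · rw [mul_zero, zero_smul]
    simp only [key]
    -- In this half of the normally ordered product the factor `g` acts first with mode `j`, which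
    -- forces `j = g.2.2` independently of `n`. What remains is the mode `n - 1 - g.2.2` of `h` on
    -- the vacuum: a creation mode if `n ≤ g.2.2`, and otherwise a nonnegative mode, which kills the
    -- vacuum.
    rw [finsum_eq_single _ g.2.2 (fun j hj => if_neg (by tauto))]
    rcases le_or_gt n g.2.2 with hn | hn
    · rw [show (n : ℤ) - 1 - g.2.2 = -1 - ((g.2.2 - n : ℕ) : ℤ) by omega, fld_neg_vac]
      simp [hn, smul_smul]
    · rw [show (n : ℤ) - 1 - g.2.2 = ((n - 1 - g.2.2 : ℕ) : ℤ) by omega, fld_vac p h _ (by omega),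
        smul_zero, ite_self, if_neg (by omega)]

end Wick

/-! ### One summand of the superconformal vector and its image under `D` -/

section Weights

variable {A : Type*} (p : A → ZMod 2)

/-- The summand `α :∂φ_a φ^ā: + β :φ_a ∂φ^ā: + :Dφ_a Dφ^ā:` of a superconformal vector. -/
def quad (α β : ℂ) (a : A) : Fock p :=
  α • (Fch p).nprod ((Fch p).der (phi p a)) (phibar p a)
    + β • (Fch p).nprod (phi p a) ((Fch p).der (phibar p a))
    + (Fch p).nprod ((Fch p).D (phi p a)) ((Fch p).D (phibar p a))

lemma D_gen (s : Base A) : (Fch p).D (gen p s) = X _ (s, 1, 0) := by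
  change DD p (X _ (s, 0, 0)) = _
  rw [DD_X]
  simp [dc, dg]

lemma der_gen (s : Base A) : (Fch p).der (gen p s) = X _ (s, 0, 1) := by
  change (Fch p).D ((Fch p).D (gen p s)) = _
  rw [D_gen]
  change DD p (X _ (s, 1, 0)) = _
  rw [DD_X]
  simp [dc, dg, show (1 : ZMod 2) + 1 = 0 from rfl]

lemma quad_eq (α β : ℂ) (a : A) : quad p α β a
    = α • (X _ (Sum.inl a, 0, 1) * X _ (Sum.inr a, 0, 0))
      + β • (X _ (Sum.inl a, 0, 0) * X _ (Sum.inr a, 0, 1))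
      + X _ (Sum.inl a, 1, 0) * X _ (Sum.inr a, 1, 0) := by
  -- `gen` has to stay folded while `D_gen` and `der_gen` fire; it is opened only afterwards, so
  -- that the remaining left factors have the form required by `Fch_nprod`.
  simp only [quad, phi, phibar, D_gen, der_gen, Fch_nprod]
  simp only [gen, Fch_nprod]

/-- This is the odd Leibniz rule, with `D² = ∂`. Applied to `Dφ Dφ̄` it yields `∂φ Dφ̄` and, since
`Dφ` has parity `p a + 1`, also `-(-1)^(p(a)) Dφ ∂φ̄`; these merge with two of the four terms coming
from `α` and `β`. In every resulting product exactly one factor carries a `D`: the factor from `φ^ā`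
in the terms that act on `φ_a`, and the factor from `φ_a` in those that act on `φ^ā`. -/
lemma DD_quad (α β : ℂ) (a : A) : DD p (quad p α β a)
    = α • (X _ (Sum.inl a, 1, 1) * X _ (Sum.inr a, 0, 0))
      + (β - sg (p a)) • (X _ (Sum.inl a, 1, 0) * X _ (Sum.inr a, 0, 1))
      + (1 + α * sg (p a)) • (X _ (Sum.inl a, 0, 1) * X _ (Sum.inr a, 1, 0))
      + (β * sg (p a)) • (X _ (Sum.inl a, 0, 0) * X _ (Sum.inr a, 1, 1)) := by
  rw [quad_eq]
  simp only [map_add, map_smul, DD_mul, DD_X]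
  simp [dc, dg, gpar, bpar, sg_add, show (1 : ZMod 2) + 1 = 0 from rfl]
  module

/-- The shifted superconformal vector as a single sum over the basis. -/
lemma Tsh_eq [Fintype A] (t : A → ℂ) : Tsh p t
    = ∑ a, quad p (if p a = 0 then t a + 1 else t a) (if p a = 0 then t a else t a + 1) a := by
  rw [← Finset.sum_filter_add_sum_filter_not Finset.univ (fun a => p a = 0), Tsh]
  congr 1
  · refine Finset.sum_congr rfl fun a ha => ?_
    rw [if_pos (Finset.mem_filter.mp ha).2, if_pos (Finset.mem_filter.mp ha).2, quad]
  · refine Finset.sum_congr (Finset.filter_congr fun a _ => ?_) fun a ha => ?_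
    -- The second sum in `Tsh` is indexed by `p a = 1`, the complement of the first by `p a ≠ 0`; in
    -- `ZMod 2` these agree.
    · rcases zmod2_cases (p a) with h | h <;> simp [h]
    · have h := (Finset.mem_filter.mp ha).2
      rw [if_neg (by simp_all), if_neg (by simp_all), quad]

/-! ### Modes of one summand on the generators -/

/-- Neither factor of any product belonging to `b` is built from the partner of `s`: `swap`
exchanges the two symbols of `b`, so if `s` is not one of them, neither is `s.swap`. Hence there is
nothing to contract. -/
lemma YY_quad_of_ne (α β : ℂ) {b : A} {s : Base A} (h1 : s ≠ Sum.inl b) (h2 : s ≠ Sum.inr b)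
    (n : ℕ) : (YY p (quad p α β b)).1 n (gen p s) = 0
      ∧ (YY p (DD p (quad p α β b))).1 n (gen p s) = 0 := by
  have h1' : Sum.inr b ≠ s.swap := by
    rintro h; exact h1 (by rw [← s.swap_swap, ← h]; rfl)
  have h2' : Sum.inl b ≠ s.swap := by
    rintro h; exact h2 (by rw [← s.swap_swap, ← h]; rfl)
  -- The vanishing does not depend on the derivatives carried by the two factors, so one statement
  -- covers all products in `quad` and in its image under `D`.
  have hw : ∀ d k d' k', (YY p (X _ (Sum.inl b, d, k) * X _ (Sum.inr b, d', k'))).1 n (gen p s)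
      = 0 := by
    intro d k d' k'
    rw [YY_X_mul_X_gen]
    simp [h1', h2']
  rw [DD_quad, quad_eq]
  simp only [map_add, map_smul, Submodule.coe_add, Submodule.coe_smul,
    Pi.add_apply, Pi.smul_apply, LinearMap.add_apply,
    LinearMap.smul_apply, hw]
  simp

/-- The terms with `α` and `β` contain no `D` and cannot contract with a generator. In `Dφ Dφ̄` the
second factor contracts with `φ_a` and leaves `Dφ`; it carries no `∂`, so only `n = 0` survives.
This is the `χ` part of the bracket. -/
lemma YY_quad_phi (α β : ℂ) (a : A) (n : ℕ) : (YY p (quad p α β a)).1 n (phi p a)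
    = if n = 0 then X _ (Sum.inl a, 1, 0) else 0 := by
  rw [quad_eq, phi]
  simp only [map_add, map_smul, Submodule.coe_add, Submodule.coe_smul, Pi.add_apply,
    Pi.smul_apply, LinearMap.add_apply, LinearMap.smul_apply, YY_X_mul_X_gen]
  simp [cb_zero]

/-- As for `φ_a`, only `Dφ Dφ̄` matters, but now the first factor contracts and `Dφ̄` is created.
Moving one past the other costs no sign, because `Dφ` and `Dφ̄` have opposite parities. -/
lemma YY_quad_phibar (α β : ℂ) (a : A) (n : ℕ) : (YY p (quad p α β a)).1 n (phibar p a)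
    = if n = 0 then X _ (Sum.inr a, 1, 0) else 0 := by
  rw [quad_eq, phibar]
  simp only [map_add, map_smul, Submodule.coe_add, Submodule.coe_smul, Pi.add_apply,
    Pi.smul_apply, LinearMap.add_apply, LinearMap.smul_apply, YY_X_mul_X_gen]
  -- The exchange sign has exponent `(p a + 1) p a`, up to `1 + 1 = 0`; it vanishes for either
  -- parity.
  rcases zmod2_cases (p a) with h | h <;>
    simp [cb_zero, gpar, bpar, h, show (1 : ZMod 2) + 1 = 0 from rfl]

/-- Of the four terms of `DD_quad`, those whose second factor carries the `D` contract with `φ_a`.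
The term `∂φ Dφ̄` contributes only to `n = 0`. In `φ ∂Dφ̄` the contracted factor carries one `∂`:
this gives the sign `-1`, and leaves `∂φ` for `n = 0` and `φ` for `n = 1`. So the weight of `φ_a` is
governed by `β` alone. -/
lemma YY_DD_quad_phi (α β : ℂ) (a : A) (n : ℕ) : (YY p (DD p (quad p α β a))).1 n (phi p a)
    = if n = 0 then (1 + (α - β) * sg (p a)) • X _ (Sum.inl a, 0, 1)
      else if n = 1 then (-β * sg (p a)) • phi p a else 0 := by
  rw [DD_quad, phi]
  simp only [map_add, map_smul, Submodule.coe_add, Submodule.coe_smul,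
    Pi.add_apply, Pi.smul_apply, LinearMap.add_apply,
    LinearMap.smul_apply, YY_X_mul_X_gen]
  -- No contracted factor has more than one `∂`, so every condition `n ≤ k` of the Wick formula
  -- fails from `n = 2` on; this is the absence of higher powers of `λ`.
  rcases n with _ | _ | n
  · simp [cb_zero, cb_neg_one]
    module
  · simp [cb_zero, gen]
    module
  · simp

/-- Now the terms whose first factor carries the `D` contract. The other factor is an
undifferentiated `φ̄` or `∂φ̄`, and both factors have parity `p a + 1`, so exchanging them costs
`-(-1)^(p(a))`. For `∂Dφ φ̄` this combines with the `-1` from the derivative to `(-1)^(p(a))`, and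
this term alone reaches `n = 1`; hence the weight of `φ^ā` is governed by `α`. For `Dφ ∂φ̄` the
product `(β - ε)(-ε) = 1 - β ε`, with `ε = (-1)^(p(a))`, restores the same coefficient of `∂` as on
`φ_a`. -/
lemma YY_DD_quad_phibar (α β : ℂ) (a : A) (n : ℕ) :
    (YY p (DD p (quad p α β a))).1 n (phibar p a)
    = if n = 0 then (1 + (α - β) * sg (p a)) • X _ (Sum.inr a, 0, 1)
      else if n = 1 then (α * sg (p a)) • phibar p a else 0 := by
  rw [DD_quad, phibar]
  simp only [map_add, map_smul, Submodule.coe_add, Submodule.coe_smul,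
    Pi.add_apply, Pi.smul_apply, LinearMap.add_apply,
    LinearMap.smul_apply, YY_X_mul_X_gen]
  have h2 : (1 : ZMod 2) + 1 = 0 := rfl
  rcases n with _ | _ | n
  -- Splitting by parity evaluates the exchange sign and uses `ε² = 1`. The factor `cb 1 (-1) = 1`
  -- comes from creating `∂φ̄` out of the vacuum.
  · rcases zmod2_cases (p a) with h | h <;>
      simp [cb_zero, cb_neg_one, gpar, bpar, h, h2] <;> module
  · rcases zmod2_cases (p a) with h | h <;> simp [cb_zero, gen, gpar, bpar, h, h2]
    module
  · simp

/-! ### From the modes of the superconformal vector to the `Λ`-bracket -/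

/-- A vector whose modes `T_(n|i) v` are those of a primary vector. -/
lemma bracket_eq_weightPart {T v : Fock p} {Δ : ℂ}
    (h1 : ∀ n : ℕ, (YY p T).1 n v = if n = 0 then (Fch p).D v else 0)
    (h0 : ∀ n : ℕ, (YY p (DD p T)).1 n v
      = if n = 0 then (2 : ℂ) • (Fch p).der v else if n = 1 then (2 * Δ) • v else 0) :
    (Fch p).bracket T v = (Fch p).weightPart Δ v := by
  ext ⟨j, i⟩
  change ((j.factorial : ℂ)⁻¹) • smode p j i T v = _
  simp only [SUSYVertexAlgebra.weightPart, Finsupp.add_apply, Finsupp.single_apply]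
  rcases zmod2_cases i with rfl | rfl
  · rw [smode_zero, h0]
    -- The factors `1 / j!` are invisible: they equal `1` for `j = 0` and `j = 1`, and the modes
    -- vanish for larger `j`.
    rcases j with _ | _ | j <;> simp
  · rw [smode_one, h1]
    rcases j with _ | j <;> simp

/-- The generators belonging to `a` see only the summand indexed by `a`: modes are additive in the
vector, and the other summands do not contract. This reduces the statement about `Tsh` to the
computations for a single `quad`. -/
lemma YY_Tsh_gen [Fintype A] (t : A → ℂ) {a : A} {s : Base A} (hs : s = Sum.inl a ∨ s = Sum.inr a)
    (n : ℕ) :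
    (YY p (Tsh p t)).1 n (gen p s) = (YY p (quad p (if p a = 0 then t a + 1 else t a)
        (if p a = 0 then t a else t a + 1) a)).1 n (gen p s)
      ∧ (YY p (DD p (Tsh p t))).1 n (gen p s) = (YY p (DD p (quad p
        (if p a = 0 then t a + 1 else t a) (if p a = 0 then t a else t a + 1) a))).1 n
          (gen p s) := by
  have hne : ∀ b, b ≠ a → s ≠ Sum.inl b ∧ s ≠ Sum.inr b := by
    intro b hb
    rcases hs with rfl | rfl <;> simp [hb.symm]
  rw [Tsh_eq]
  simp only [map_sum, AddSubmonoidClass.coe_finsetSum, Finset.sum_apply, LinearMap.sum_apply]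
  exact ⟨Finset.sum_eq_single a
      (fun b _ hb => (YY_quad_of_ne p _ _ (hne b hb).1 (hne b hb).2 n).1) (by simp),
    Finset.sum_eq_single a
      (fun b _ hb => (YY_quad_of_ne p _ _ (hne b hb).1 (hne b hb).2 n).2) (by simp)⟩

/-- The normalization of the superconformal vector: `α - β` equals `(-1)^(p(a))` for both parities,
so the degree zero part of the bracket is `2∂v`, and `t a` cancels from it. -/
lemma one_add_sub_mul_sg (t : A → ℂ) (a : A) :
    1 + ((if p a = 0 then t a + 1 else t a) - (if p a = 0 then t a else t a + 1)) * sg (p a)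
      = 2 := by
  rcases zmod2_cases (p a) with h | h <;> simp [h] <;> norm_num

/-- `φ_a` is primary. -/
theorem bracket_Tsh_phi [Fintype A] (t : A → ℂ) (a : A) :
    (Fch p).bracket (Tsh p t) (phi p a)
      = (Fch p).weightPart (if p a = 0 then -(1 / 2) * t a else 1 / 2 * t a + 1 / 2) (phi p a) := by
  refine bracket_eq_weightPart p (fun n => ?_) (fun n => ?_)
  · rw [phi, (YY_Tsh_gen p t (Or.inl rfl) n).1, D_gen]
    exact YY_quad_phi p _ _ a n
  · rw [phi, (YY_Tsh_gen p t (Or.inl rfl) n).2, der_gen]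
    refine (YY_DD_quad_phi p _ _ a n).trans ?_
    rw [one_add_sub_mul_sg]
    -- With the coefficient of `∂` already equal to `2`, what is left is the equation `-β
    -- (-1)^(p(a)) = 2Δ` for the coefficient of `λ`.
    congr 3
    rcases zmod2_cases (p a) with h | h <;> simp [h]
    ring

/-- `φ^ā` is primary. -/
theorem bracket_Tsh_phibar [Fintype A] (t : A → ℂ) (a : A) :
    (Fch p).bracket (Tsh p t) (phibar p a)
      = (Fch p).weightPart (if p a = 0 then 1 / 2 * t a + 1 / 2 else -(1 / 2) * t a)
          (phibar p a) := by
  refine bracket_eq_weightPart p (fun n => ?_) (fun n => ?_)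
  · rw [phibar, (YY_Tsh_gen p t (Or.inr rfl) n).1, D_gen]
    exact YY_quad_phibar p _ _ a n
  · rw [phibar, (YY_Tsh_gen p t (Or.inr rfl) n).2, der_gen]
    refine (YY_DD_quad_phibar p _ _ a n).trans ?_
    rw [one_add_sub_mul_sg]
    -- The remaining equation is `α (-1)^(p(a)) = 2Δ`.
    congr 3
    rcases zmod2_cases (p a) with h | h <;> simp [h]
    ring

end Weights

end

/-- An exact bracket formula determines a weight with remainder `O(Λ^2)` equal to zero. -/
lemma SUSYVertexAlgebra.hasConformalWeight_of_bracket_eq {V : Type*} [AddCommGroup V] [Module ℂ V]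
    {𝒱 : SUSYVertexAlgebra V} {T v : V} {Δ : ℂ} (h : 𝒱.bracket T v = 𝒱.weightPart Δ v) :
    𝒱.HasConformalWeight T v Δ :=
  ⟨0, rfl, rfl, rfl, by rw [h, add_zero]⟩

end SusyVA

/-- Conformal weights of the generators `φ_a`, `φ^ā` of the SUSY charged free fermion vertex algebra
with respect to the shifted superconformal vector `T_sh`, and their primarity. Here `A` indexes a
homogeneous basis of a finite-dimensional superspace, with parities `p`. -/
theorem proposition4p9 {A : Type*} [Fintype A] (p : A → ZMod 2) (t : A → ℂ) (a : A) :
    (p a = 0 →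
      (SusyVA.Fch p).HasConformalWeight (SusyVA.Tsh p t) (SusyVA.phi p a) (-(1 / 2) * t a) ∧
      (SusyVA.Fch p).HasConformalWeight (SusyVA.Tsh p t) (SusyVA.phibar p a)
        (1 / 2 * t a + 1 / 2)) ∧
    (p a = 1 →
      (SusyVA.Fch p).HasConformalWeight (SusyVA.Tsh p t) (SusyVA.phi p a) (1 / 2 * t a + 1 / 2) ∧
      (SusyVA.Fch p).HasConformalWeight (SusyVA.Tsh p t) (SusyVA.phibar p a) (-(1 / 2) * t a)) ∧
    (SusyVA.Fch p).IsPrimary (SusyVA.Tsh p t) (SusyVA.phi p a) ∧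
    (SusyVA.Fch p).IsPrimary (SusyVA.Tsh p t) (SusyVA.phibar p a) := by
  have h1 := SusyVA.bracket_Tsh_phi p t a
  have h2 := SusyVA.bracket_Tsh_phibar p t a
  -- Primarity is the bracket formula itself and needs no case distinction: its witness is the
  -- weight defined by cases on the parity of `a`. The parity hypotheses only select the branch.
  refine ⟨fun h => ?_, fun h => ?_, ⟨_, h1⟩, ⟨_, h2⟩⟩
  · rw [if_pos h] at h1 h2
    exact ⟨SusyVA.SUSYVertexAlgebra.hasConformalWeight_of_bracket_eq h1,
      SusyVA.SUSYVertexAlgebra.hasConformalWeight_of_bracket_eq h2⟩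
  · have h' : p a ≠ 0 := by simp [h]
    rw [if_neg h'] at h1 h2
    exact ⟨SusyVA.SUSYVertexAlgebra.hasConformalWeight_of_bracket_eq h1,
      SusyVA.SUSYVertexAlgebra.hasConformalWeight_of_bracket_eq h2⟩
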